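/- **Setting.** A *dimension function* is a map $\Phi:(0,1)\to[0,\infty)$ such that $R^{1+\Phi(R)}$ decreases (weakly) as $R$ decreases to $0$. For a subset $E$ of a metric space let $N_r(E)$ be the least number of balls of radius $r$ that cover $E$. The *upper $\Phi$-dimension* of $E$ is $$\overline{\dim}_\Phi E=\inf\Bigl\{\alpha:\ \exists\,c_1\in(0,1],\ c_2>0\ \ \forall\, 0<r\le R^{1+\Phi(R)}\le R<c_1:\ \ \sup_{x\in E}N_r(B(x,R)\cap E)\le c_2\Bigl(\frac Rr\Bigr)^{\alpha}\Bigr\}.$$ Let $a=(a_j)_{j\ge1}$ be a non-negative (weakly) decreasing sequence with $\sum_j a_j=1$, and put $s_n=2^{-n}\sum_{j\ge 2^n}a_j$ for $n\ge0$. The sequence $a$ is *level comparable* if there are a constant $\kappa$ with $a_n\le\kappa a_{2n}$ for all $n\ge1$ and constants $\tau,\lambda$ with $0<\tau\le s_{n+1}/s_n\le\lambda<1/2$ for all $n\ge0$. The *depth function* $\phi(n)$ is the least integer $j\ge0$ with $s_{n+j}\le s_n^{1+\Phi(s_n)}$, for $n\ge1$. $\mathcal C_a$ is the family of all sets $[0,1]\setminus\bigcup_jU_j$,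 where the $U_j$ are pairwise disjoint open subintervals of $[0,1]$ and $U_j$ has length $a_j$. The decreasing countable set is $D_a=\{0\}\cup\{\sum_{i\ge k}a_i:k\ge1\}$. For a (strict) total order $\triangleleft$ on $\mathbb N=\{1,2,\dots\}$ let $$K_\triangleleft=[0,1]\setminus\bigcup_i J_i(\triangleleft),\qquad J_i(\triangleleft)=\Bigl(\sum_{j\triangleleft i}a_j,\ a_i+\sum_{j\triangleleft i}a_j\Bigr),$$ a member of $\mathcal C_a$. On the set $\mathcal O$ of total orders on $\mathbb N$ take the $\sigma$-algebra generated by the sets of all orders with a prescribed restriction to a finite set $F\subset\mathbb N$, and the probability measure that gives each of these sets the mass $1/|F|!$ (equivalently, the law of the order $i\triangleleft j\Leftrightarrow\omega_i<\omega_j$ for i.i.d. $\omega_i$ uniform on $[0,1]$). "Almost every $E\in\mathcal C_a$" means $E=K_\triangleleft$ for almost every $\triangleleft\in\mathcal O$. **Theorem 4.3.** Let $a$ be level comparable and let $\Phi$ be a dimension function. Then $$\lim_{x\to0^+}\frac{\Phi(x)}{\log|\log x|/|\log x|}=0\quad\Longleftrightarrow\quad\lim_{n\to\infty}\frac{\phi(n)}{\log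 n}=0 .$$ If these conditions hold, then $\overline{\dim}_\Phi E=1$ for almost every $E\in\mathcal C_a$. Moreover $1$ is then the maximal value on $\mathcal C_a$, attained by the decreasing set: $\overline{\dim}_\Phi E\le1$ for every $E\in\mathcal C_a$, and $D_a$ is a countable member of $\mathcal C_a$ with $\overline{\dim}_\Phi D_a=1$. -/

import Mathlib

open Filter Topology MeasureTheory Asymptotics Set
open scoped ENNReal NNReal

noncomputable section

namespace CompSets

/-! ### Dimension functions and upper `Φ`-dimensions -/

/-- `Φ : (0,1) → [0,∞)` is a dimension function if `R ^ (1 + Φ R)` decreases as `R` decreases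
to `0`. Only the values of `Φ` on `(0,1)` matter. -/
structure IsDimensionFunction (Φ : ℝ → ℝ) : Prop where
  nonneg : ∀ x ∈ Ioo (0 : ℝ) 1, 0 ≤ Φ x
  mono : MonotoneOn (fun R : ℝ => R ^ (1 + Φ R)) (Ioo 0 1)

/-- `N_r(S)`: the least number of (closed) balls of radius `r`, centred anywhere in `X`,
that cover `S`. -/
def coverNumber {X : Type*} [PseudoMetricSpace X] (r : ℝ) (S : Set X) : ℕ∞ :=
  Metric.externalCoveringNumber r.toNNReal S

/-- The exponents `α` that are admissible in the definition of the upper `Φ`-dimension of `E`. -/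
def upperPhiExponents {X : Type*} [PseudoMetricSpace X] (Φ : ℝ → ℝ) (E : Set X) : Set ℝ :=
  {α | ∃ c₁ c₂ : ℝ, 0 < c₁ ∧ c₁ ≤ 1 ∧ 0 < c₂ ∧
    ∀ r R : ℝ, 0 < r → r ≤ R ^ (1 + Φ R) → 0 < R → R < c₁ →
      ∀ x ∈ E, (coverNumber r (Metric.closedBall x R ∩ E) : ℝ≥0∞) ≤
        ENNReal.ofReal (c₂ * (R / r) ^ α)}

/-- The upper `Φ`-dimension, an infimum taken in the extended reals. -/
def upperPhiDim {X : Type*} [PseudoMetricSpace X] (Φ : ℝ → ℝ) (E : Set X) : EReal :=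
  sInf ((fun α : ℝ => (α : EReal)) '' upperPhiExponents Φ E)

/-! ### Level comparable sequences -/

/-- `s_n = 2^{-n} ∑_{j ≥ 2^n} a_j`. -/
def avgLength (a : ℕ+ → ℝ) (n : ℕ) : ℝ :=
  ((2 : ℝ) ^ n)⁻¹ * ∑' j : ℕ+, if 2 ^ n ≤ (j : ℕ) then a j else 0

/-- A non-negative decreasing sequence `a = (a_1, a_2, …)` of sum one is level comparable if it is
doubling and `0 < τ ≤ s_{n+1} / s_n ≤ lam < 1/2` for all `n`. -/
structure IsLevelComparable (a : ℕ+ → ℝ) : Prop where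
  nonneg : ∀ j, 0 ≤ a j
  anti : Antitone a
  hasSum : HasSum a 1
  doubling : ∃ κ : ℝ, ∀ n : ℕ+, a n ≤ κ * a (2 * n)
  ratio : ∃ τ lam : ℝ, 0 < τ ∧ lam < 1 / 2 ∧
    ∀ n : ℕ, τ ≤ avgLength a (n + 1) / avgLength a n ∧
      avgLength a (n + 1) / avgLength a n ≤ lam

/-- The depth function: `φ(n)` is the least `j` with `s_{n+j} ≤ s_n ^ (1 + Φ(s_n))`. -/
def depth (Φ : ℝ → ℝ) (a : ℕ+ → ℝ) (n : ℕ) : ℕ :=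
  sInf {j : ℕ | avgLength a (n + j) ≤ avgLength a n ^ (1 + Φ (avgLength a n))}

/-! ### Complementary sets -/

/-- The family `𝒞_a`: the sets `[0,1] \ ⋃ U_j` where the `U_j` are pairwise disjoint open
subintervals of `[0,1]` and `U_j` has length `a_j`. -/
def complementarySets (a : ℕ+ → ℝ) : Set (Set ℝ) :=
  {E | ∃ l : ℕ+ → ℝ, (∀ j, Ioo (l j) (l j + a j) ⊆ Icc 0 1) ∧
    Pairwise (fun i j => Disjoint (Ioo (l i) (l i + a i)) (Ioo (l j) (l j + a j))) ∧
    E = Icc 0 1 \ ⋃ j, Ioo (l j) (l j + a j)}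

/-- The decreasing rearrangement `D_a = {∑_{i ≥ k} a_i : k ≥ 1} ∪ {0}` (the point `0` is the
limit of the others and makes the set closed). -/
def decreasingSet (a : ℕ+ → ℝ) : Set ℝ :=
  insert 0 (range fun k : ℕ+ => ∑' i : ℕ+, if k ≤ i then a i else 0)

/-! ### Random total orders -/

/-- Strict total orders on a type. -/
@[ext]
structure TotalOrder (α : Type*) where
  lt : α → α → Prop
  irrefl : ∀ i, ¬ lt i i
  trans : ∀ i j k, lt i j → lt j k → lt i k
  total : ∀ i j, i ≠ j → lt i j ∨ lt j i

/-- The restriction of a total order on `α` to a finite subset. -/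
def TotalOrder.restrict {α : Type*} (o : TotalOrder α) (F : Finset α) : TotalOrder F where
  lt i j := o.lt i j
  irrefl i := o.irrefl i
  trans i j k := o.trans i j k
  total i j h := o.total i j (fun h' => h (Subtype.ext h'))

/-- The set of the total orders whose restriction to the finite set `F` is `t`. -/
def orderCylinder {α : Type*} (F : Finset α) (t : TotalOrder F) : Set (TotalOrder α) :=
  {o | o.restrict F = t}

/-- The σ-algebra on the space of total orders that is generated by the cylinders. -/
instance instMeasurableSpaceTotalOrder {α : Type*} : MeasurableSpace (TotalOrder α) :=
  MeasurableSpace.generateFrom {S | ∃ (F : Finset α) (t : TotalOrder F), S = orderCylinder F t}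

/-- The total order on the positive integers induced by a sequence `ω` of points of `[0,1]`:
`i` precedes `j` if `ω i < ω j` (a tie is decided by the usual order). -/
def orderOfSample (ω : ℕ+ → unitInterval) : TotalOrder ℕ+ where
  lt i j := ω i < ω j ∨ (ω i = ω j ∧ i < j)
  irrefl i := by simp
  trans i j k := by
    rintro (h | ⟨h, h'⟩) (g | ⟨g, g'⟩)
    · exact Or.inl (h.trans g)
    · exact Or.inl (g ▸ h)
    · exact Or.inl (h ▸ g)
    · exact Or.inr ⟨h.trans g, h'.trans g'⟩
  total i j hij := by
    rcases lt_trichotomy (ω i) (ω j) with h | h | h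
    · exact Or.inl (Or.inl h)
    · rcases lt_or_gt_of_ne hij with h' | h'
      · exact Or.inl (Or.inr ⟨h, h'⟩)
      · exact Or.inr (Or.inr ⟨h.symm, h'⟩)
    · exact Or.inr (Or.inl h)

/-- The law of an i.i.d. sequence of uniform points of `[0,1]`. -/
def sampleMeasure : Measure (ℕ+ → unitInterval) :=
  Measure.infinitePi fun _ => (volume : Measure unitInterval)

/-- The uniform random total order on the positive integers. It is the probability measure on the
space of total orders that gives every cylinder over `F` the mass `1 / |F|!`; see
`orderMeasure_cylinder` and `measurable_orderOfSample`. -/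
def orderMeasure : Measure (TotalOrder ℕ+) :=
  sampleMeasure.map orderOfSample

theorem orderOfSample_preimage (F : Finset ℕ+) (t : TotalOrder F) :
    orderOfSample ⁻¹' orderCylinder F t =
      {ω | ∀ i j : F, (ω i < ω j ∨ (ω i = ω j ∧ (i : ℕ+) < j)) ↔ t.lt i j} := by
  ext ω
  simp only [mem_preimage, orderCylinder, mem_ofPred_eq, TotalOrder.ext_iff, funext_iff,
    TotalOrder.restrict, orderOfSample, eq_iff_iff]

theorem measurable_orderOfSample : Measurable orderOfSample := by
  refine measurable_generateFrom ?_
  rintro _ ⟨F, t, rfl⟩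
  rw [orderOfSample_preimage]
  refine measurableSet_setOfPred.2 (Measurable.forall fun i => Measurable.forall fun j =>
    Measurable.iff ?_ measurable_const)
  refine Measurable.or ?_ (Measurable.and ?_ measurable_const)
  · exact measurableSet_setOfPred.1
      (measurableSet_lt (measurable_pi_apply _) (measurable_pi_apply _))
  · exact measurableSet_setOfPred.1
      (measurableSet_eq_fun (measurable_pi_apply _) (measurable_pi_apply _))

instance : IsProbabilityMeasure sampleMeasure := by
  unfold sampleMeasure; infer_instance

instance : IsProbabilityMeasure orderMeasure :=
  Measure.isProbabilityMeasure_map measurable_orderOfSample.aemeasurable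

theorem ae_injective_sample : ∀ᵐ ω ∂sampleMeasure, Function.Injective ω := by
  have h : ∀ i j : ℕ+, i ≠ j → ∀ᵐ ω ∂sampleMeasure, ω i ≠ ω j := by
    intro i j hij
    have h1 := Measure.infinitePi_map_eval_prod
      (P := fun _ : ℕ+ => (volume : Measure unitInterval)) hij
    have hd : MeasurableSet {p : unitInterval × unitInterval | p.1 = p.2} :=
      measurableSet_eq_fun measurable_fst measurable_snd
    have h2 : ((volume : Measure unitInterval).prod volume)
        {p : unitInterval × unitInterval | p.1 = p.2} = 0 := by
      rw [Measure.measure_prod_null hd]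
      refine Filter.Eventually.of_forall fun x => ?_
      have : Prod.mk x ⁻¹' {p : unitInterval × unitInterval | p.1 = p.2} = {x} := by
        ext y; simp [eq_comm]
      change volume (Prod.mk x ⁻¹' {p : unitInterval × unitInterval | p.1 = p.2}) = 0
      rw [this]; simp
    rw [← h1, Measure.map_apply (by fun_prop) hd] at h2
    rw [ae_iff]
    simpa [sampleMeasure] using h2
  have h' : ∀ᵐ ω ∂sampleMeasure, ∀ i j : ℕ+, i ≠ j → ω i ≠ ω j := by
    rw [ae_all_iff]; intro i
    rw [ae_all_iff]; intro j
    by_cases hij : i = j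
    · simp [hij]
    · filter_upwards [h i j hij] with ω hω _ using hω
  filter_upwards [h'] with ω hω i j hij
  by_contra hne
  exact hω i j hne hij

theorem measurableSet_strictMono_sample {n : ℕ} (g : Fin n → ℕ+) :
    MeasurableSet {ω : ℕ+ → unitInterval | StrictMono fun k => ω (g k)} := by
  have : {ω : ℕ+ → unitInterval | StrictMono fun k => ω (g k)} =
      {ω | ∀ i j : Fin n, i < j → ω (g i) < ω (g j)} := rfl
  rw [this]
  refine measurableSet_setOfPred.2 (Measurable.forall fun i => Measurable.forall fun j =>
    Measurable.imp measurable_const ?_)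
  exact measurableSet_setOfPred.1
    (measurableSet_lt (measurable_pi_apply _) (measurable_pi_apply _))

theorem sampleMeasure_strictMono_eq {n : ℕ} (g g' : Fin n → ℕ+) (hg : Function.Injective g)
    (hg' : Function.Injective g') :
    sampleMeasure {ω | StrictMono fun k => ω (g k)} =
      sampleMeasure {ω | StrictMono fun k => ω (g' k)} := by
  have hm : MeasurableSet {x : Fin n → unitInterval | StrictMono x} := by
    have : {x : Fin n → unitInterval | StrictMono x} = {x | ∀ i j : Fin n, i < j → x i < x j} := rfl
    rw [this]
    refine measurableSet_setOfPred.2 (Measurable.forall fun i => Measurable.forall fun j =>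
      Measurable.imp measurable_const ?_)
    exact measurableSet_setOfPred.1
      (measurableSet_lt (measurable_pi_apply _) (measurable_pi_apply _))
  have key : ∀ f : Fin n → ℕ+, Function.Injective f →
      sampleMeasure {ω | StrictMono fun k => ω (f k)} =
        Measure.infinitePi (fun _ : Fin n => (volume : Measure unitInterval))
          {x | StrictMono x} := by
    intro f hf
    have h := Measure.map_infinitePi_infinitePi_of_inj
      (P := fun _ : ℕ+ => (volume : Measure unitInterval)) hf
    rw [← h, Measure.map_apply (by fun_prop) hm]
    rfl
  rw [key g hg, key g' hg']

/-- The `n!` orderings of a sample of size `n` are equally likely. -/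
theorem sampleMeasure_strictMono (F : Finset ℕ+) (g : Fin F.card ≃ F) :
    sampleMeasure {ω | StrictMono fun k => ω (g k)} = ((F.card.factorial : ℕ) : ℝ≥0∞)⁻¹ := by
  classical
  let B : (Fin F.card ≃ F) → Set (ℕ+ → unitInterval) :=
    fun e => {ω | StrictMono fun k => ω (e k)}
  have hinj : ∀ e : Fin F.card ≃ F, Function.Injective fun k => ((e k : F) : ℕ+) :=
    fun e => Subtype.val_injective.comp e.injective
  have hdisj : Pairwise (Function.onFun Disjoint B) := by
    intro e e' hne
    refine Set.disjoint_left.2 fun ω h h' => hne ?_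
    have hr : Set.range (fun k => ω (e k)) = Set.range (fun k => ω (e' k)) := by
      have h1 := e.surjective.range_comp (fun x : F => ω x)
      have h2 := e'.surjective.range_comp (fun x : F => ω x)
      exact h1.trans h2.symm
    have heq := (StrictMono.range_inj h h').1 hr
    ext k
    have hF : Function.Injective fun x : F => ω x := by
      have := h.injective.comp e.symm.injective
      simpa [Function.comp_def] using this
    have := hF (congrFun heq k)
    rw [this]
  have hcover : sampleMeasure (⋃ e, B e) = 1 := by
    rw [← prob_compl_eq_zero_iff
      (MeasurableSet.iUnion fun e => measurableSet_strictMono_sample _)]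
    change ∀ᵐ ω ∂sampleMeasure, ω ∈ ⋃ e, B e
    filter_upwards [ae_injective_sample] with ω hω
    refine mem_iUnion.2 ⟨(Tuple.sort fun k => ω (g k)).trans g, ?_⟩
    have hm := Tuple.monotone_sort fun k => ω (g k)
    refine hm.strictMono_of_injective ?_
    exact (hω.comp (hinj g)).comp (Equiv.injective _)
  have hsum : ∑ e, sampleMeasure (B e) = 1 := by
    rw [← hcover, measure_iUnion hdisj (fun e => measurableSet_strictMono_sample _), tsum_fintype]
  have hall : ∀ e, sampleMeasure (B e) = sampleMeasure (B g) :=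
    fun e => sampleMeasure_strictMono_eq _ _ (hinj e) (hinj g)
  simp only [hall, Finset.sum_const, Finset.card_univ, nsmul_eq_mul] at hsum
  rw [Fintype.card_equiv g, Fintype.card_fin] at hsum
  exact ENNReal.eq_inv_of_mul_eq_one_left (by rw [mul_comm]; exact hsum)

/-- A total order on a finite type is given by an enumeration. -/
theorem TotalOrder.exists_enum {β : Type*} [Fintype β] (t : TotalOrder β) {n : ℕ}
    (hn : Fintype.card β = n) : ∃ g : Fin n ≃ β, ∀ k l, k < l ↔ t.lt (g k) (g l) := by
  classical
  let _ : LinearOrder β :=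
    { lt := t.lt
      le := fun i j => i = j ∨ t.lt i j
      le_refl := fun i => Or.inl rfl
      le_trans := by
        rintro i j k (rfl | h) (rfl | g)
        · exact Or.inl rfl
        · exact Or.inr g
        · exact Or.inr h
        · exact Or.inr (t.trans _ _ _ h g)
      le_antisymm := by
        rintro i j (rfl | h) (g | g)
        · rfl
        · rfl
        · exact g.symm
        · exact absurd (t.trans _ _ _ h g) (t.irrefl _)
      lt_iff_le_not_ge := by
        intro i j
        constructor
        · intro h
          refine ⟨Or.inr h, ?_⟩
          rintro (rfl | g)
          · exact t.irrefl _ h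
          · exact t.irrefl _ (t.trans _ _ _ h g)
        · rintro ⟨rfl | h, g⟩
          · exact absurd (Or.inl rfl) g
          · exact h
      le_total := by
        intro i j
        by_cases h : i = j
        · exact Or.inl (Or.inl h)
        · exact (t.total i j h).imp Or.inr Or.inr
      toDecidableLE := Classical.decRel _ }
  exact ⟨(Fintype.orderIsoFinOfCardEq β hn).toEquiv,
    fun k l => ((Fintype.orderIsoFinOfCardEq β hn).lt_iff_lt (x := k) (y := l)).symm⟩

/-- Every cylinder over a finite set `F` has probability `1 / |F|!`. -/
theorem orderMeasure_cylinder (F : Finset ℕ+) (t : TotalOrder F) :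
    orderMeasure (orderCylinder F t) = ((F.card.factorial : ℕ) : ℝ≥0∞)⁻¹ := by
  obtain ⟨g, hg⟩ := t.exists_enum (Fintype.card_coe F)
  have hm : MeasurableSet (orderCylinder F t) :=
    MeasurableSpace.measurableSet_generateFrom ⟨F, t, rfl⟩
  rw [orderMeasure, Measure.map_apply measurable_orderOfSample hm, orderOfSample_preimage,
    ← sampleMeasure_strictMono F g]
  refine measure_congr ?_
  filter_upwards [ae_injective_sample] with ω hω
  refine propext ?_
  change (∀ i j : F, _ ↔ t.lt i j) ↔ StrictMono fun k => ω (g k)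
  constructor
  · intro h k l hkl
    rcases (h (g k) (g l)).2 ((hg k l).1 hkl) with h' | ⟨h', -⟩
    · exact h'
    · exact absurd (g.injective (Subtype.val_injective (hω h'))) hkl.ne
  · intro h i j
    obtain ⟨k, rfl⟩ := g.surjective i
    obtain ⟨l, rfl⟩ := g.surjective j
    rw [← hg, ← h.lt_iff_lt]
    constructor
    · rintro (h' | ⟨h', h''⟩)
      · exact h'
      · exact absurd (hω h') h''.ne
    · exact Or.inl

/-- The sum of the `a_j` over the `j` that precede `i`: the left end point of the gap `J_i`. -/
def gapLeft (a : ℕ+ → ℝ) (o : TotalOrder ℕ+) (i : ℕ+) : ℝ :=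
  open Classical in ∑' j : ℕ+, if o.lt j i then a j else 0

/-- The set `K_◁ = [0, ∑ a_i] \ ⋃ J_i`, where `J_i` is the open interval of length `a_i` that
starts at `∑_{j ◁ i} a_j`. -/
def orderedSet (a : ℕ+ → ℝ) (o : TotalOrder ℕ+) : Set ℝ :=
  Icc 0 (∑' i, a i) \ ⋃ i, Ioo (gapLeft a o i) (gapLeft a o i + a i)

theorem hasSum_ite_self (a : ℕ+ → ℝ) (i : ℕ+) :
    HasSum (fun j => if j = i then a j else 0) (a i) := by
  have h := hasSum_single (f := fun j => if j = i then a j else 0) i (fun j hj => if_neg hj)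
  simpa using h

theorem gapLeft_nonneg {a : ℕ+ → ℝ} (h0 : ∀ j, 0 ≤ a j) (o : TotalOrder ℕ+) (i : ℕ+) :
    0 ≤ gapLeft a o i := by
  classical
  refine tsum_nonneg fun j => ?_
  split_ifs
  exacts [h0 j, le_rfl]

theorem summable_ite {a : ℕ+ → ℝ} (h0 : ∀ j, 0 ≤ a j) (hs : Summable a) (p : ℕ+ → Prop)
    [DecidablePred p] : Summable fun j => if p j then a j else 0 :=
  Summable.of_nonneg_of_le (fun j => by split_ifs; exacts [h0 j, le_rfl])
    (fun j => by split_ifs; exacts [le_rfl, h0 j]) hs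

/-- The end of a gap is at most any sum that contains the gap and everything preceding it. -/
theorem gapLeft_add_le {a : ℕ+ → ℝ} (h0 : ∀ j, 0 ≤ a j) (hs : Summable a) (o : TotalOrder ℕ+)
    (i : ℕ+) (p : ℕ+ → Prop) [DecidablePred p] (hi : p i) (hp : ∀ j, o.lt j i → p j) :
    gapLeft a o i + a i ≤ ∑' j, if p j then a j else 0 := by
  classical
  have h1 : HasSum (fun j => if j = i then a j else 0) (a i) := hasSum_ite_self a i
  have h2 := (summable_ite h0 hs fun j => o.lt j i).hasSum.add h1
  refine hasSum_le (fun j => ?_) h2 (summable_ite h0 hs p).hasSum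
  by_cases hj : j = i
  · subst hj; simp [o.irrefl, hi]
  · by_cases hl : o.lt j i
    · simp [hl, hj, hp j hl]
    · simp only [hl, hj, if_false, add_zero]
      split_ifs
      exacts [h0 j, le_rfl]

theorem orderedSet_mem_complementarySets {a : ℕ+ → ℝ} (h0 : ∀ j, 0 ≤ a j) (hs : HasSum a 1)
    (o : TotalOrder ℕ+) : orderedSet a o ∈ complementarySets a := by
  classical
  have key : ∀ i j, o.lt i j →
      Disjoint (Ioo (gapLeft a o i) (gapLeft a o i + a i))
        (Ioo (gapLeft a o j) (gapLeft a o j + a j)) := by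
    intro i j hij
    have := gapLeft_add_le h0 hs.summable o i (fun k => o.lt k j) hij
      (fun k hk => o.trans _ _ _ hk hij)
    refine Set.disjoint_left.2 fun x hx hy => ?_
    have h1 := hx.2
    have h2 := hy.1
    simp only [gapLeft] at *
    linarith
  refine ⟨gapLeft a o, fun i => ?_, fun i j hij => ?_, ?_⟩
  · refine Ioo_subset_Icc_self.trans (Icc_subset_Icc (gapLeft_nonneg h0 o i) ?_)
    have := gapLeft_add_le h0 hs.summable o i (fun _ => True) trivial (fun _ _ => trivial)
    simpa [hs.tsum_eq] using this
  · rcases o.total i j hij with h | h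
    · exact key i j h
    · exact (key j i h).symm
  · rw [orderedSet, hs.tsum_eq]

theorem tendsto_tail (a : ℕ+ → ℝ) :
    Tendsto (fun k : ℕ+ => ∑' i : ℕ+, if k ≤ i then a i else 0) atTop (𝓝 0) := by
  have h1 : ∀ k : ℕ+, (∑' i : ℕ+, if k ≤ i then a i else 0) =
      ∑' i : {i // i ∉ Finset.Iio k}, a i := by
    intro k
    have : (fun i : ℕ+ => if k ≤ i then a i else 0) =
        Set.indicator {i | i ∉ Finset.Iio k} a := by
      ext i; simp [Set.indicator_apply]
    rw [this]
    exact (tsum_subtype {i | i ∉ Finset.Iio k} a).symm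
  simp only [h1]
  exact (tendsto_tsum_compl_atTop_zero a).comp
    (tendsto_atTop_finset_of_monotone (fun _ _ h => Finset.Iio_subset_Iio h)
      fun i => ⟨i + 1, by simp⟩)

theorem decreasingSet_mem_complementarySets {a : ℕ+ → ℝ} (h0 : ∀ j, 0 ≤ a j) (hs : HasSum a 1) :
    decreasingSet a ∈ complementarySets a := by
  classical
  let t : ℕ+ → ℝ := fun k => ∑' i : ℕ+, if k ≤ i then a i else 0
  have hsum : ∀ k : ℕ+, HasSum (fun i => if k ≤ i then a i else 0) (t k) :=
    fun k => (summable_ite h0 hs.summable _).hasSum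
  have hstep : ∀ k, t k = t (k + 1) + a k := by
    intro k
    have h1 : HasSum (fun j => if j = k then a j else 0) (a k) := hasSum_ite_self a k
    refine (hsum k).unique (((hsum (k + 1)).add h1).congr_fun ?_)
    intro i
    rcases lt_trichotomy i k with h | h | h
    · have h2 : ¬ k ≤ i := not_le.2 h
      have h3 : ¬ k + 1 ≤ i := fun h' => h2 ((PNat.lt_add_right k 1).le.trans h')
      simp [h2, h3, h.ne]
    · subst h; simp
    · simp [h.le, h.ne', PNat.add_one_le_iff.2 h]
  have hanti : Antitone t := by
    intro k l hkl
    refine hasSum_le (fun i => ?_) (hsum l) (hsum k)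
    by_cases h : l ≤ i
    · simp [h, hkl.trans h]
    · simp only [h, if_false]; split_ifs; exacts [h0 i, le_rfl]
  have hnn : ∀ k, 0 ≤ t k := fun k => (hsum k).nonneg (fun i => by
    split_ifs; exacts [h0 i, le_rfl])
  have ht1 : t 1 = 1 := by
    have : t 1 = ∑' i, a i := by simp [t]
    rw [this, hs.tsum_eq]
  have hlim : Tendsto t atTop (𝓝 0) := tendsto_tail a
  have hle1 : ∀ k, t k ≤ 1 := fun k => ht1 ▸ hanti one_le
  have hdisj : ∀ i j, i < j →
      Disjoint (Ioo (t (i + 1)) (t (i + 1) + a i)) (Ioo (t (j + 1)) (t (j + 1) + a j)) := by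
    intro i j hij
    rw [← hstep, ← hstep]
    refine Set.disjoint_left.2 fun x hx hy => ?_
    have := hanti (PNat.add_one_le_iff.2 hij)
    linarith [hx.1, hy.2]
  refine ⟨fun k => t (k + 1), fun k => ?_, fun i j hij => ?_, ?_⟩
  · rw [← hstep]
    exact Ioo_subset_Icc_self.trans (Icc_subset_Icc (hnn _) (hle1 _))
  · rcases lt_or_gt_of_ne hij with h | h
    · exact hdisj i j h
    · exact (hdisj j i h).symm
  · simp only [← hstep]
    change insert 0 (range t) = _
    ext x
    constructor
    · rintro (rfl | ⟨k, rfl⟩)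
      · refine ⟨by simp, ?_⟩
        simp only [mem_iUnion, not_exists]
        intro i hi
        exact absurd hi.1 (not_lt.2 (hnn _))
      · refine ⟨⟨hnn k, hle1 k⟩, ?_⟩
        simp only [mem_iUnion, not_exists]
        intro i hi
        rcases lt_or_ge i k with h | h
        · exact absurd hi.1 (not_lt.2 (hanti (PNat.add_one_le_iff.2 h)))
        · exact absurd hi.2 (not_lt.2 (hanti h))
    · rintro ⟨⟨hx0, hx1⟩, hx⟩
      by_contra hne
      simp only [mem_insert_iff, mem_range, not_or, not_exists] at hne
      have hpos : 0 < x := lt_of_le_of_ne hx0 (Ne.symm hne.1)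
      have hall : ∀ k : ℕ+, x < t k := by
        intro k
        induction k using PNat.recOn with
        | one => rw [ht1]; exact lt_of_le_of_ne hx1 (fun h => hne.2 1 (ht1.trans h.symm))
        | succ k ih =>
          by_contra hcon
          have hlt : t (k + 1) < x := lt_of_le_of_ne (not_lt.1 hcon) (hne.2 _)
          exact hx (mem_iUnion.2 ⟨k, hlt, ih⟩)
      obtain ⟨k, hk⟩ := ((hlim.eventually (gt_mem_nhds hpos))).exists
      exact absurd (hall k) (not_lt.2 hk.le)

end CompSets

end

open CompSets

/-!
Write `s_n` for the average lengths. Level comparability makes `s_{n+j} / s_n` lie between `τ ^ j`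
and `λ ^ j` (`IsLevelComparable.exists_pow_bounds`), so `|log s_n|` is of the order `n`, and the
defining property of the depth makes `φ(n)` comparable to `Φ(s_n) |log s_n|`
(`exists_depth_bounds`). Along `x = s_n` this is the equivalence of the two smallness conditions;
for `x` between `s_{n+1}` and `s_n` it follows from the monotonicity of `R ^ (1 + Φ R)`.

Every set of reals has upper `Φ`-dimension at most one. For the lower bounds it suffices to find,
at scales `R → 0`, a piece of the set that has length `R` and no holes much larger than `r`, where
`r ≤ R ^ (1 + Φ R)` and `R / r → ∞` (`one_le_upperPhiDim`). Under the smallness condition `R ^ Φ(R)`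
is at least any small negative power of `|log R|`, so `r = s_N` and `R = c 2 ^ m s_N` are allowed as
soon as `N` is at most of the order `4 ^ m` (`scales_admissible`).

* In the decreasing set the piece is `[0, 2 ^ m s_m]`: it contains only the gaps with indices
  `j ≥ 2 ^ m`, whose lengths are at most of the order `s_m` by doubling.
* For the random order take `N = 4 ^ m + m`, and divide `[0, 1]`, where the uniform sample that
  induces the order lives, into `2 ^ 4 ^ m` boxes. A box contains on average `2 ^ m` of the sample
  points with indices in the block `[2 ^ N, 2 ^ (N + 1))`. It contains none of those with indices
  below `2 ^ N` with a probability of about `exp (-2 ^ m)`, which is far larger than the reciprocal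
  of the number of boxes. Boxes are negatively correlated, so a second moment estimate
  (`measure_forall_box_le`) shows that, up to a probability that is summable in `m`, some box
  without small indices has at least half the expected number of block points. These are
  consecutive in the order up to gaps of index at least `2 ^ N`, each of them has length of the
  order `s_N`, and together they span the required piece (`exists_interval_of_isolatedRun`).
  Borel–Cantelli finishes the argument.
-/

namespace CompSets

/-! ### Tails and average lengths of a level comparable sequence -/

section Levels

variable {a : ℕ+ → ℝ}

theorem two_pow_mul_avgLength (a : ℕ+ → ℝ) (n : ℕ) :
    (2 : ℝ) ^ n * avgLength a n = ∑' j : ℕ+, if 2 ^ n ≤ (j : ℕ) then a j else 0 := by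
  rw [avgLength, mul_inv_cancel_left₀ (by positivity)]

theorem card_Ico_two_pow (n : ℕ) : (Finset.Ico ((2 : ℕ+) ^ n) (2 ^ (n + 1))).card = 2 ^ n := by
  rw [PNat.card_Ico, PNat.pow_coe, PNat.pow_coe, pow_succ]
  simp only [PNat.val_ofNat]
  omega

namespace IsLevelComparable

theorem avgLength_zero (ha : IsLevelComparable a) : avgLength a 0 = 1 := by
  have h : ∀ j : ℕ+, (2 ^ 0 ≤ (j : ℕ)) := fun j => j.pos
  simp only [avgLength, h, if_true, ha.hasSum.tsum_eq]
  norm_num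

theorem avgLength_pos (ha : IsLevelComparable a) (n : ℕ) : 0 < avgLength a n := by
  obtain ⟨τ, lam, hτ, -, h⟩ := ha.ratio
  have h0 : 0 ≤ avgLength a n := by
    refine mul_nonneg (by positivity) (tsum_nonneg fun j => ?_)
    split_ifs
    exacts [ha.nonneg j, le_rfl]
  refine h0.lt_of_ne fun h' => ?_
  have := (h n).1
  rw [← h', div_zero] at this
  exact absurd this (not_le.2 hτ)

/-- The iterated ratio bounds: the average lengths decay geometrically between any two levels. -/
theorem exists_pow_bounds (ha : IsLevelComparable a) : ∃ τ lam : ℝ, 0 < τ ∧ τ ≤ lam ∧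
    lam < 1 / 2 ∧ ∀ n j : ℕ, τ ^ j * avgLength a n ≤ avgLength a (n + j) ∧
      avgLength a (n + j) ≤ lam ^ j * avgLength a n := by
  obtain ⟨τ, lam, hτ, hlam, h⟩ := ha.ratio
  have hle : τ ≤ lam := (h 0).1.trans (h 0).2
  refine ⟨τ, lam, hτ, hle, hlam, fun n j => ?_⟩
  induction j with
  | zero => simp
  | succ j ih =>
    have h1 := h (n + j)
    rw [le_div_iff₀ (ha.avgLength_pos _), div_le_iff₀ (ha.avgLength_pos _)] at h1
    rw [← add_assoc]
    constructor
    · calc τ ^ (j + 1) * avgLength a n = τ * (τ ^ j * avgLength a n) := by ring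
        _ ≤ τ * avgLength a (n + j) := by gcongr; exact ih.1
        _ ≤ _ := h1.1
    · calc avgLength a (n + j + 1) ≤ lam * avgLength a (n + j) := h1.2
        _ ≤ lam * (lam ^ j * avgLength a n) :=
          mul_le_mul_of_nonneg_left ih.2 (hτ.le.trans hle)
        _ = _ := by ring

theorem strictAnti_avgLength (ha : IsLevelComparable a) : StrictAnti (avgLength a) := by
  obtain ⟨τ, lam, hτ, hle, hlam, h⟩ := ha.exists_pow_bounds
  refine strictAnti_nat_of_succ_lt fun n => (h n 1).2.trans_lt ?_
  have := ha.avgLength_pos n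
  rw [pow_one]
  nlinarith

theorem tendsto_two_pow_mul_avgLength (ha : IsLevelComparable a) :
    Tendsto (fun n => (2 : ℝ) ^ n * avgLength a n) atTop (𝓝 0) := by
  obtain ⟨τ, lam, hτ, hle, hlam, h⟩ := ha.exists_pow_bounds
  refine squeeze_zero (g := fun n => (2 * lam) ^ n)
    (fun n => mul_nonneg (by positivity) (ha.avgLength_pos n).le) (fun n => ?_)
    (tendsto_pow_atTop_nhds_zero_of_lt_one (by linarith) (by linarith))
  have := (h 0 n).2
  rw [zero_add, ha.avgLength_zero, mul_one] at this
  rw [mul_pow]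
  gcongr

theorem tendsto_avgLength (ha : IsLevelComparable a) :
    Tendsto (avgLength a) atTop (𝓝 0) :=
  squeeze_zero (fun n => (ha.avgLength_pos n).le)
    (fun n => le_mul_of_one_le_left (ha.avgLength_pos n).le (one_le_pow₀ (by norm_num)))
    ha.tendsto_two_pow_mul_avgLength

/-- The tail from `2 ^ n` splits into the dyadic block and the next tail. -/
theorem two_pow_mul_avgLength_eq (ha : IsLevelComparable a) (n : ℕ) :
    (2 : ℝ) ^ n * avgLength a n =
      ∑ j ∈ Finset.Ico ((2 : ℕ+) ^ n) (2 ^ (n + 1)), a j +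
        2 ^ (n + 1) * avgLength a (n + 1) := by
  rw [two_pow_mul_avgLength, two_pow_mul_avgLength]
  have h1 : HasSum (fun j : ℕ+ => if j ∈ Finset.Ico ((2 : ℕ+) ^ n) (2 ^ (n + 1)) then a j else 0)
      (∑ j ∈ Finset.Ico ((2 : ℕ+) ^ n) (2 ^ (n + 1)), a j) := by
    have := hasSum_sum_of_ne_finset_zero (L := .unconditional ℕ+) (s := Finset.Ico ((2 : ℕ+) ^ n) (2 ^ (n + 1)))
      (f := fun j : ℕ+ => if j ∈ Finset.Ico ((2 : ℕ+) ^ n) (2 ^ (n + 1)) then a j else 0)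
      (fun j hj => if_neg hj)
    rwa [Finset.sum_congr rfl fun j hj => if_pos hj] at this
  have h2 := (summable_ite ha.nonneg ha.hasSum.summable
    fun j : ℕ+ => 2 ^ (n + 1) ≤ (j : ℕ)).hasSum
  rw [← (h1.add h2).tsum_eq]
  refine tsum_congr fun j => ?_
  have e1 : (2 : ℕ+) ^ n ≤ j ↔ 2 ^ n ≤ (j : ℕ) := by
    rw [← PNat.coe_le_coe, PNat.pow_coe]; rfl
  have e2 : j < (2 : ℕ+) ^ (n + 1) ↔ (j : ℕ) < 2 ^ (n + 1) := by
    rw [← PNat.coe_lt_coe, PNat.pow_coe]; rfl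
  have h3 : 2 ^ n ≤ 2 ^ (n + 1) := Nat.pow_le_pow_right (by norm_num) n.le_succ
  simp only [Finset.mem_Ico, e1, e2]
  by_cases h4 : 2 ^ (n + 1) ≤ (j : ℕ)
  · simp [h4, not_lt.2 h4, h3.trans h4]
  · simp [h4, not_le.1 h4]

/-- The lengths at the beginning of a dyadic block are at most of the order of the average
length of the tail. -/
theorem exists_le_mul_avgLength (ha : IsLevelComparable a) :
    ∃ C : ℝ, 0 < C ∧ ∀ n : ℕ, a (2 ^ n) ≤ C * avgLength a n := by
  obtain ⟨κ, hκ⟩ := ha.doubling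
  refine ⟨max κ 1, by positivity, fun n => ?_⟩
  have h1 : a (2 ^ (n + 1)) ≤ avgLength a n := by
    refine le_of_mul_le_mul_left ?_ (show (0 : ℝ) < 2 ^ n by positivity)
    rw [ha.two_pow_mul_avgLength_eq n]
    have := Finset.card_nsmul_le_sum (Finset.Ico ((2 : ℕ+) ^ n) (2 ^ (n + 1))) a
      (a (2 ^ (n + 1))) fun j hj => ha.anti (Finset.mem_Ico.1 hj).2.le
    rw [card_Ico_two_pow, nsmul_eq_mul] at this
    push_cast at this
    have h2 := mul_pos (show (0 : ℝ) < 2 ^ (n + 1) by positivity) (ha.avgLength_pos (n + 1))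
    linarith
  calc a (2 ^ n) ≤ κ * a (2 * 2 ^ n) := hκ _
    _ = κ * a (2 ^ (n + 1)) := by rw [pow_succ']
    _ ≤ max κ 1 * a (2 ^ (n + 1)) := mul_le_mul_of_nonneg_right (le_max_left _ _) (ha.nonneg _)
    _ ≤ _ := by gcongr

/-- The lengths in a dyadic block are at least of the order of the average length of the tail;
here `lam < 1 / 2` enters, which makes the tail after the block a small part of the whole. -/
theorem exists_mul_avgLength_le (ha : IsLevelComparable a) :
    ∃ c : ℝ, 0 < c ∧ ∀ n : ℕ, c * avgLength a n ≤ a (2 ^ (n + 1)) := by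
  obtain ⟨τ, lam, hτ, hle, hlam, h⟩ := ha.exists_pow_bounds
  refine ⟨(1 - 2 * lam) * τ, mul_pos (by linarith) hτ, fun n => ?_⟩
  have h1 : (1 - 2 * lam) * avgLength a (n + 1) ≤ a (2 ^ (n + 1)) := by
    refine le_of_mul_le_mul_left ?_ (show (0 : ℝ) < 2 ^ (n + 1) by positivity)
    have h2 := ha.two_pow_mul_avgLength_eq (n + 1)
    have h3 := Finset.sum_le_card_nsmul (Finset.Ico ((2 : ℕ+) ^ (n + 1)) (2 ^ (n + 1 + 1))) a
      (a (2 ^ (n + 1))) fun j hj => ha.anti (Finset.mem_Ico.1 hj).1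
    rw [card_Ico_two_pow, nsmul_eq_mul] at h3
    push_cast at h3
    have h4 := (h (n + 1) 1).2
    rw [pow_one] at h4
    have h5 : (2 : ℝ) ^ (n + 1 + 1) * avgLength a (n + 1 + 1) ≤
        2 ^ (n + 1 + 1) * (lam * avgLength a (n + 1)) := by gcongr
    have h6 : (2 : ℝ) ^ (n + 1 + 1) * (lam * avgLength a (n + 1)) =
        2 * lam * (2 ^ (n + 1) * avgLength a (n + 1)) := by ring
    nlinarith
  have h2 := (h n 1).1
  rw [pow_one] at h2
  calc (1 - 2 * lam) * τ * avgLength a n = (1 - 2 * lam) * (τ * avgLength a n) := by ring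
    _ ≤ (1 - 2 * lam) * avgLength a (n + 1) := mul_le_mul_of_nonneg_left h2 (by linarith)
    _ ≤ _ := h1

theorem avgLength_lt_one (ha : IsLevelComparable a) {n : ℕ} (hn : 1 ≤ n) :
    avgLength a n < 1 := by
  rw [← ha.avgLength_zero]
  exact ha.strictAnti_avgLength hn

/-- `|log s_n|` is comparable to `n`. -/
theorem exists_log_bounds (ha : IsLevelComparable a) : ∃ A B : ℝ, 0 < A ∧ 0 < B ∧
    (∀ n j : ℕ, j * A ≤ Real.log (avgLength a n) - Real.log (avgLength a (n + j)) ∧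
      Real.log (avgLength a n) - Real.log (avgLength a (n + j)) ≤ j * B) := by
  obtain ⟨τ, lam, hτ, hle, hlam, h⟩ := ha.exists_pow_bounds
  have hl0 : 0 < lam := hτ.trans_le hle
  refine ⟨-Real.log lam, -Real.log τ, neg_pos.2 (Real.log_neg hl0 (by linarith)),
    neg_pos.2 (Real.log_neg hτ (by linarith)), fun n j => ?_⟩
  have hn := ha.avgLength_pos n
  have hnj := ha.avgLength_pos (n + j)
  have h1 := Real.log_le_log (by positivity) (h n j).1
  have h2 := Real.log_le_log hnj (h n j).2
  rw [Real.log_mul (by positivity) hn.ne', Real.log_pow] at h1 h2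
  constructor <;> linarith

end IsLevelComparable

/-! ### Smallness of the dimension function in terms of the depth function -/

/-- The smallness condition without quotients. -/
theorem isLittleO_logLog_iff {Φ : ℝ → ℝ} (hΦ : IsDimensionFunction Φ) :
    (Φ =o[𝓝[>] 0] fun x : ℝ => Real.log |Real.log x| / |Real.log x|) ↔
      ∀ c : ℝ, 0 < c → ∀ᶠ x in 𝓝[>] (0 : ℝ),
        Φ x * |Real.log x| ≤ c * Real.log |Real.log x| := by
  rw [isLittleO_iff]
  refine forall_congr' fun c => imp_congr_right fun _ => eventually_congr ?_
  have h1 : ∀ᶠ x in 𝓝[>] (0 : ℝ), x < Real.exp (-1) :=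
    eventually_nhdsWithin_of_eventually_nhds (eventually_lt_nhds (Real.exp_pos _))
  filter_upwards [h1, self_mem_nhdsWithin] with x hx hx0
  have hlog : Real.log x < -1 := (Real.log_lt_iff_lt_exp hx0).2 hx
  have habs : 1 < |Real.log x| := by rw [abs_of_neg (by linarith)]; linarith
  have hx1 : x < 1 := hx.trans (Real.exp_lt_one_iff.2 (by norm_num))
  rw [Real.norm_of_nonneg (hΦ.nonneg x ⟨hx0, hx1⟩), Real.norm_of_nonneg
    (div_nonneg (Real.log_nonneg habs.le) (abs_nonneg _)), ← mul_div_assoc,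
    le_div_iff₀ (by linarith)]

theorem isLittleO_depth_iff (Φ : ℝ → ℝ) (a : ℕ+ → ℝ) :
    ((fun n : ℕ => (depth Φ a n : ℝ)) =o[atTop] fun n : ℕ => Real.log n) ↔
      ∀ c : ℝ, 0 < c → ∀ᶠ n : ℕ in atTop, (depth Φ a n : ℝ) ≤ c * Real.log n := by
  rw [isLittleO_iff]
  refine forall_congr' fun c => imp_congr_right fun _ => eventually_congr ?_
  filter_upwards [eventually_ge_atTop 1] with n hn
  rw [Real.norm_of_nonneg (Nat.cast_nonneg _), Real.norm_of_nonneg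
    (Real.log_nonneg (by exact_mod_cast hn))]

theorem depth_spec (ha : IsLevelComparable a) (Φ : ℝ → ℝ) (n : ℕ) :
    avgLength a (n + depth Φ a n) ≤ avgLength a n ^ (1 + Φ (avgLength a n)) := by
  refine Nat.sInf_mem (s := {j : ℕ | avgLength a (n + j) ≤ _}) ?_
  have h := (tendsto_add_atTop_iff_nat n).2 ha.tendsto_avgLength
  obtain ⟨j, hj⟩ := (h.eventually
    (gt_mem_nhds (Real.rpow_pos_of_pos (ha.avgLength_pos n) (1 + Φ (avgLength a n))))).exists
  exact ⟨j, by rw [mem_ofPred_eq, add_comm]; exact hj.le⟩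

theorem lt_avgLength_of_lt_depth {Φ : ℝ → ℝ} {n j : ℕ} (hj : j < depth Φ a n) :
    avgLength a n ^ (1 + Φ (avgLength a n)) < avgLength a (n + j) := by
  by_contra h
  exact Nat.notMem_of_lt_sInf hj (not_lt.1 h)

/-- The depth function records `Φ` at the average lengths: `φ(n)` is comparable to
`Φ(s_n) |log s_n|`, up to an additive constant. -/
theorem exists_depth_bounds (ha : IsLevelComparable a) {Φ : ℝ → ℝ}
    (hΦ : IsDimensionFunction Φ) : ∃ A B : ℝ, 0 < A ∧ 0 < B ∧ ∀ n : ℕ, 1 ≤ n →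
      n * A ≤ |Real.log (avgLength a n)| ∧ |Real.log (avgLength a n)| ≤ n * B ∧
      |Real.log (avgLength a (n + 1))| ≤ |Real.log (avgLength a n)| + B ∧
      Φ (avgLength a n) * |Real.log (avgLength a n)| ≤ depth Φ a n * B ∧
      (depth Φ a n - 1 : ℝ) * A ≤ Φ (avgLength a n) * |Real.log (avgLength a n)| := by
  obtain ⟨A, B, hA, hB, h⟩ := ha.exists_log_bounds
  refine ⟨A, B, hA, hB, fun n hn => ?_⟩
  have hs := ha.avgLength_pos n
  have habs : ∀ {m}, 1 ≤ m → |Real.log (avgLength a m)| = -Real.log (avgLength a m) :=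
    fun hm => abs_of_neg (Real.log_neg (ha.avgLength_pos _) (ha.avgLength_lt_one hm))
  have h0 := h 0 n
  rw [zero_add, ha.avgLength_zero, Real.log_one] at h0
  have h1 := (h n 1).2
  rw [Nat.cast_one, one_mul] at h1
  rw [habs hn, habs (m := n + 1) (by omega)]
  refine ⟨by linarith, by linarith, by linarith, ?_, ?_⟩
  · have h2 := Real.log_le_log (ha.avgLength_pos _) (depth_spec ha Φ n)
    rw [Real.log_rpow hs] at h2
    have h3 := (h n (depth Φ a n)).2
    linarith
  · rcases Nat.eq_zero_or_pos (depth Φ a n) with h2 | h2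
    · rw [h2]
      have := mul_nonneg (hΦ.nonneg _ ⟨hs, ha.avgLength_lt_one hn⟩)
        (abs_nonneg (Real.log (avgLength a n)))
      rw [habs hn] at this
      push_cast
      linarith
    · have h3 := Real.log_lt_log (Real.rpow_pos_of_pos hs _)
        (lt_avgLength_of_lt_depth (Nat.sub_lt h2 one_pos))
      rw [Real.log_rpow hs] at h3
      have h4 := (h n (depth Φ a n - 1)).1
      rw [Nat.cast_sub h2, Nat.cast_one] at h4
      linarith

theorem tendsto_log_natCast : Tendsto (fun n : ℕ => Real.log n) atTop atTop :=
  Real.tendsto_log_atTop.comp tendsto_natCast_atTop_atTop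

theorem isLittleO_depth_of_isLittleO (ha : IsLevelComparable a) {Φ : ℝ → ℝ}
    (hΦ : IsDimensionFunction Φ)
    (h : Φ =o[𝓝[>] 0] fun x : ℝ => Real.log |Real.log x| / |Real.log x|) :
    (fun n : ℕ => (depth Φ a n : ℝ)) =o[atTop] fun n : ℕ => Real.log n := by
  rw [isLittleO_logLog_iff hΦ] at h
  rw [isLittleO_depth_iff]
  obtain ⟨A, B, hA, hB, hb⟩ := exists_depth_bounds ha hΦ
  intro c hc
  have hlim : Tendsto (avgLength a) atTop (𝓝[>] 0) :=
    tendsto_nhdsWithin_iff.2 ⟨ha.tendsto_avgLength, Eventually.of_forall ha.avgLength_pos⟩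
  filter_upwards [hlim.eventually (h (c * A / 2) (by positivity)), eventually_ge_atTop 1,
    tendsto_log_natCast.eventually_ge_atTop ((A + c * A / 2 * Real.log B) / (c * A / 2))]
    with n hn h1 h2
  obtain ⟨h3, h4, -, -, h5⟩ := hb n h1
  have hn0 : (0 : ℝ) < n := by exact_mod_cast h1
  have h6 : Real.log |Real.log (avgLength a n)| ≤ Real.log n + Real.log B := by
    rw [← Real.log_mul hn0.ne' hB.ne']
    exact Real.log_le_log ((mul_pos hn0 hA).trans_le h3) h4
  have h7 : c * A / 2 * Real.log |Real.log (avgLength a n)| ≤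
      c * A / 2 * (Real.log n + Real.log B) := by gcongr
  rw [div_le_iff₀ (by positivity)] at h2
  refine le_of_mul_le_mul_right ?_ hA
  linarith

theorem isLittleO_of_isLittleO_depth (ha : IsLevelComparable a) {Φ : ℝ → ℝ}
    (hΦ : IsDimensionFunction Φ)
    (h : (fun n : ℕ => (depth Φ a n : ℝ)) =o[atTop] fun n : ℕ => Real.log n) :
    Φ =o[𝓝[>] 0] fun x : ℝ => Real.log |Real.log x| / |Real.log x| := by
  rw [isLittleO_depth_iff] at h
  rw [isLittleO_logLog_iff hΦ]
  obtain ⟨A, B, hA, hB, hb⟩ := exists_depth_bounds ha hΦ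
  intro c hc
  -- a threshold beyond which the estimate holds on the whole interval `[s_{n+1}, s_n)`
  have hev : ∀ᶠ n : ℕ in atTop, 1 ≤ n ∧
      (depth Φ a (n + 1) : ℝ) * B + B ≤ c * (Real.log n + Real.log A) := by
    have h1 := (tendsto_add_atTop_nat 1).eventually (h (c / (2 * B)) (by positivity))
    filter_upwards [h1, eventually_ge_atTop 1, tendsto_log_natCast.eventually_ge_atTop
      ((c / 2 * Real.log 2 + B - c * Real.log A) / (c / 2))] with n h1 h2 h3
    refine ⟨h2, ?_⟩
    have hn0 : (0 : ℝ) < n := by exact_mod_cast h2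
    have h4 : Real.log ((n + 1 : ℕ) : ℝ) ≤ Real.log 2 + Real.log n := by
      rw [← Real.log_mul two_ne_zero hn0.ne']
      refine Real.log_le_log (by positivity) ?_
      have : (1 : ℝ) ≤ n := by exact_mod_cast h2
      push_cast
      linarith
    have h5 : (depth Φ a (n + 1) : ℝ) * B ≤ c / 2 * Real.log ((n + 1 : ℕ) : ℝ) := by
      calc (depth Φ a (n + 1) : ℝ) * B ≤ c / (2 * B) * Real.log ((n + 1 : ℕ) : ℝ) * B := by gcongr
        _ = _ := by field_simp
    have h6 : c / 2 * Real.log ((n + 1 : ℕ) : ℝ) ≤ c / 2 * (Real.log 2 + Real.log n) := by gcongr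
    rw [div_le_iff₀ (by positivity)] at h3
    linarith
  obtain ⟨n₀, hn₀⟩ := eventually_atTop.1 hev
  have hx : ∀ᶠ x in 𝓝[>] (0 : ℝ), x < avgLength a n₀ :=
    eventually_nhdsWithin_of_eventually_nhds (eventually_lt_nhds (ha.avgLength_pos _))
  filter_upwards [hx, self_mem_nhdsWithin] with x hx hx0
  -- locate `x` in `[s_{n+1}, s_n)` and compare `x ^ (1 + Φ x)` with its value at `s_{n+1}`
  have hex : ∃ k, avgLength a k ≤ x :=
    ((ha.tendsto_avgLength.eventually (gt_mem_nhds hx0)).exists).imp fun _ => le_of_lt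
  classical
  have hk := Nat.find_spec hex
  have hkn : n₀ < Nat.find hex := ha.strictAnti_avgLength.lt_iff_gt.1 (hk.trans_lt hx)
  obtain ⟨n, hn⟩ : ∃ n, Nat.find hex = n + 1 := ⟨Nat.find hex - 1, by omega⟩
  have hlt : x < avgLength a n := not_le.1 (Nat.find_min hex (by omega))
  rw [hn] at hk hkn
  obtain ⟨h1, h2⟩ := hn₀ n (by omega)
  have hn0 : (0 : ℝ) < n := by exact_mod_cast h1
  have hx1 : x < 1 := hlt.trans (ha.avgLength_lt_one h1)
  obtain ⟨h3, -, h4, -, -⟩ := hb n h1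
  obtain ⟨-, -, -, h5, -⟩ := hb (n + 1) (by omega)
  have hs1 := ha.avgLength_pos (n + 1)
  have hs1' := ha.avgLength_lt_one (n := n + 1) (by omega)
  have h6 := Real.log_le_log (Real.rpow_pos_of_pos hs1 _) (hΦ.mono ⟨hs1, hs1'⟩ ⟨hx0, hx1⟩ hk)
  rw [Real.log_rpow hs1, Real.log_rpow hx0] at h6
  have h7 := Real.log_lt_log hx0 hlt
  rw [abs_of_neg (Real.log_neg hs1 hs1')] at h4 h5
  rw [abs_of_neg (Real.log_neg (ha.avgLength_pos n) (ha.avgLength_lt_one h1))] at h3 h4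
  rw [abs_of_neg (Real.log_neg hx0 hx1)]
  have h8 : Real.log n + Real.log A ≤ Real.log (-Real.log x) := by
    rw [← Real.log_mul hn0.ne' hA.ne']
    exact Real.log_le_log (mul_pos hn0 hA) (by linarith)
  have h9 : c * (Real.log n + Real.log A) ≤ c * Real.log (-Real.log x) := by gcongr
  linarith

end Levels

/-! ### Covering numbers of subsets of the line -/

/-- A set of reals that leaves no hole larger than `g` in `[x, x + R]` needs about `R / (r + g)`
balls of radius `r`: fattened by `g`, the balls cover the whole interval. -/
theorem ofReal_le_coverNumber_mul {E : Set ℝ} {x R r g : ℝ} (hr : 0 < r) (hg : 0 ≤ g)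
    (h : ∀ y ∈ Icc x (x + R), ∃ z ∈ E, x ≤ z ∧ z ≤ y ∧ y - z ≤ g) :
    ENNReal.ofReal R ≤ (coverNumber r (Metric.closedBall x R ∩ E) : ℝ≥0∞) *
      ENNReal.ofReal (2 * (r + g)) := by
  have hmem : ∃ C : Set ℝ, Metric.IsCover r.toNNReal (Metric.closedBall x R ∩ E) C ∧
      C.encard = coverNumber r (Metric.closedBall x R ∩ E) := by
    have : Nonempty {C : Set ℝ // Metric.IsCover r.toNNReal (Metric.closedBall x R ∩ E) C} :=
      ⟨⟨_, Metric.IsCover.rfl⟩⟩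
    obtain ⟨C, hC⟩ := ciInf_mem fun C : {C : Set ℝ //
      Metric.IsCover r.toNNReal (Metric.closedBall x R ∩ E) C} => (C : Set ℝ).encard
    refine ⟨C, C.2, ?_⟩
    rw [coverNumber, Metric.externalCoveringNumber, iInf_subtype']
    exact hC
  obtain ⟨C, hC, hcard⟩ := hmem
  rw [← hcard]
  rcases C.finite_or_infinite with hfin | hinf
  · have hsub : Icc x (x + R) ⊆ ⋃ c ∈ hfin.toFinset, Metric.closedBall c (r + g) := by
      intro y hy
      obtain ⟨z, hz, hxz, hzy, hyz⟩ := h y hy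
      have hzb : z ∈ Metric.closedBall x R ∩ E := by
        refine ⟨?_, hz⟩
        rw [Real.closedBall_eq_Icc]
        constructor <;> linarith [hy.1, hy.2]
      have h1 := hC.subset_iUnion_closedBall hzb
      simp only [mem_iUnion, Real.coe_toNNReal r hr.le, Metric.mem_closedBall] at h1
      obtain ⟨c, hc, hzc⟩ := h1
      refine mem_biUnion (hfin.mem_toFinset.2 hc) ?_
      rw [Metric.mem_closedBall]
      have h2 : dist y z ≤ g := by
        rw [Real.dist_eq, abs_of_nonneg (by linarith)]
        exact hyz
      linarith [dist_triangle y z c]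
    have h1 := (measure_mono (μ := volume) hsub).trans (measure_biUnion_finset_le _ _)
    simp only [Real.volume_Icc, Real.volume_closedBall, Finset.sum_const, nsmul_eq_mul,
      add_sub_cancel_left] at h1
    rw [hfin.encard_eq_coe_toFinset_card]
    exact h1
  · rw [hinf.encard_eq]
    simp [ENNReal.top_mul, add_pos_of_pos_of_nonneg hr hg]

/-- On the line, a ball of radius `R` is covered by about `R / r` balls of radius `r ≤ R`. -/
theorem coverNumber_le {E : Set ℝ} {x R r : ℝ} (hr : 0 < r) (hrR : r ≤ R) :
    (coverNumber r (Metric.closedBall x R ∩ E) : ℝ≥0∞) ≤ ENNReal.ofReal (2 * (R / r)) := by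
  set n := ⌊R / r⌋₊ + 1 with hn
  set f : ℕ → ℝ := fun k => x - R + (2 * k + 1) * r with hf
  have hcov : Metric.IsCover r.toNNReal (Metric.closedBall x R ∩ E)
      ((Finset.range n).image f : Finset ℝ) := by
    refine .of_subset_iUnion_closedBall fun y hy => ?_
    have hy' := hy.1
    rw [Real.closedBall_eq_Icc] at hy'
    have ht0 : 0 ≤ (y - x + R) / (2 * r) := div_nonneg (by linarith [hy'.1]) (by linarith)
    have ht1 : (y - x + R) / (2 * r) ≤ R / r := by
      rw [div_le_div_iff₀ (by linarith) hr]
      nlinarith [hy'.2]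
    have h1 := Nat.floor_le ht0
    have h2 := Nat.lt_floor_add_one ((y - x + R) / (2 * r))
    rw [le_div_iff₀ (by linarith)] at h1
    rw [div_lt_iff₀ (by linarith)] at h2
    refine mem_biUnion (x := f ⌊(y - x + R) / (2 * r)⌋₊) ?_ ?_
    · simp only [Finset.coe_image, Finset.coe_range]
      refine mem_image_of_mem f ?_
      have := Nat.floor_le_floor ht1
      rw [mem_Iio]
      omega
    · rw [Metric.mem_closedBall, Real.coe_toNNReal r hr.le, Real.dist_eq, abs_le, hf]
      constructor <;> nlinarith
  have hle : coverNumber r (Metric.closedBall x R ∩ E) ≤ (n : ℕ∞) := by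
    refine hcov.externalCoveringNumber_le_encard.trans ?_
    rw [Set.encard_coe_eq_coe_finsetCard]
    exact_mod_cast Finset.card_image_le.trans (Finset.card_range n).le
  calc (coverNumber r (Metric.closedBall x R ∩ E) : ℝ≥0∞) ≤ ((n : ℕ∞) : ℝ≥0∞) := by
        exact_mod_cast hle
    _ = ENNReal.ofReal n := by simp
    _ ≤ _ := by
      refine ENNReal.ofReal_le_ofReal ?_
      have h1 : 1 ≤ R / r := (one_le_div hr).2 hrR
      have h2 := Nat.floor_le (zero_le_one.trans h1)
      rw [hn]
      push_cast
      linarith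

/-! ### Bounds for the upper `Φ`-dimension of sets of reals -/

theorem upperPhiDim_le_one {Φ : ℝ → ℝ} (hΦ : IsDimensionFunction Φ) (E : Set ℝ) :
    upperPhiDim Φ E ≤ 1 := by
  refine sInf_le ⟨1, ⟨1, 2, one_pos, le_rfl, two_pos, ?_⟩, by simp⟩
  intro r R hr hrR hR hR1 x _
  rw [Real.rpow_one]
  refine coverNumber_le hr (hrR.trans ?_)
  calc R ^ (1 + Φ R) ≤ R ^ (1 : ℝ) :=
        Real.rpow_le_rpow_of_exponent_ge hR hR1.le (by linarith [hΦ.nonneg R ⟨hR, hR1⟩])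
    _ = R := Real.rpow_one R

/-- If `E` has, at admissible scales `r < R → 0` with `R / r → ∞`, pieces of diameter `R` without
holes much larger than `r`, then its upper `Φ`-dimension is at least one. -/
theorem one_le_upperPhiDim {Φ : ℝ → ℝ} {E : Set ℝ} {r R : ℕ → ℝ} {C : ℝ} (hC : 0 ≤ C)
    (hr : ∀ m, 0 < r m) (hR : Tendsto R atTop (𝓝[>] 0))
    (hRr : Tendsto (fun m => R m / r m) atTop atTop)
    (hadm : ∀ᶠ m in atTop, r m ≤ R m ^ (1 + Φ (R m)))
    (hx : ∀ᶠ m in atTop, ∃ x ∈ E,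
      ∀ y ∈ Icc x (x + R m), ∃ z ∈ E, x ≤ z ∧ z ≤ y ∧ y - z ≤ C * r m) :
    1 ≤ upperPhiDim Φ E := by
  refine le_sInf ?_
  rintro _ ⟨α, ⟨c₁, c₂, hc₁, -, hc₂, h⟩, rfl⟩
  change ((1 : ℝ) : EReal) ≤ (α : EReal)
  rw [EReal.coe_le_coe_iff]
  by_contra! hα
  -- otherwise `(R / r) ^ (1 - α)` would stay bounded
  have hpow := (tendsto_rpow_atTop (show 0 < 1 - α by linarith)).comp hRr
  obtain ⟨m, hm1, hm2, hm3, ⟨x, hxE, hm4⟩, hm5⟩ := ((hR.eventually self_mem_nhdsWithin).and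
    ((hR.eventually (eventually_nhdsWithin_of_eventually_nhds (gt_mem_nhds hc₁))).and
      (hadm.and (hx.and (hpow.eventually_gt_atTop (c₂ * (2 * (1 + C)))))))).exists
  have hm1 : 0 < R m := hm1
  have hrm := hr m
  have hq : 0 < R m / r m := div_pos hm1 hrm
  have h1 := ofReal_le_coverNumber_mul hrm (mul_nonneg hC hrm.le) hm4
  have h2 := h1.trans (mul_le_mul_left (h (r m) (R m) hrm hm3 hm1 hm2 x hxE) _)
  rw [← ENNReal.ofReal_mul (by positivity), ENNReal.ofReal_le_ofReal_iff (by positivity)] at h2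
  have h3 : R m / r m = (R m / r m) ^ (1 - α) * (R m / r m) ^ α := by
    rw [← Real.rpow_add hq, sub_add_cancel, Real.rpow_one]
  have h4 : 0 < (R m / r m) ^ α := Real.rpow_pos_of_pos hq α
  have h5 : R m / r m ≤ c₂ * (2 * (1 + C)) * (R m / r m) ^ α := by
    rw [div_le_iff₀ hrm]
    linarith
  exact absurd (le_of_mul_le_mul_right (h3.symm.trans_le h5) h4) (not_le.2 hm5)

/-- The smallness condition makes the scales `r = s_N` and `R = c 2 ^ m s_N` admissible as long as
`N` is at most of the order `4 ^ m`: it bounds `R ^ Φ(R)` from below by any small negative power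
of `|log R|`, hence of `4 ^ m`, while `R / r` is of the order `2 ^ m`. -/
theorem scales_admissible {a : ℕ+ → ℝ} (ha : IsLevelComparable a) {Φ : ℝ → ℝ}
    (hΦ : IsDimensionFunction Φ)
    (h : Φ =o[𝓝[>] 0] fun x : ℝ => Real.log |Real.log x| / |Real.log x|) {c : ℝ} (hc : 0 < c)
    {N : ℕ → ℕ} (hN : ∀ m, m ≤ N m) (hN' : ∀ m, N m ≤ 2 * 4 ^ m) :
    Tendsto (fun m => c * 2 ^ m * avgLength a (N m)) atTop (𝓝[>] 0) ∧
    Tendsto (fun m => c * 2 ^ m * avgLength a (N m) / avgLength a (N m)) atTop atTop ∧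
    ∀ᶠ m in atTop, avgLength a (N m) ≤
      (c * 2 ^ m * avgLength a (N m)) ^ (1 + Φ (c * 2 ^ m * avgLength a (N m))) := by
  have hpos : ∀ m, 0 < c * 2 ^ m * avgLength a (N m) := fun m =>
    mul_pos (by positivity) (ha.avgLength_pos _)
  have hNt : Tendsto N atTop atTop := tendsto_atTop_mono hN tendsto_id
  have hlim : Tendsto (fun m => c * 2 ^ m * avgLength a (N m)) atTop (𝓝[>] 0) := by
    refine tendsto_nhdsWithin_iff.2 ⟨?_, Eventually.of_forall hpos⟩
    have h1 := (ha.tendsto_two_pow_mul_avgLength.comp hNt).const_mul c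
    rw [mul_zero] at h1
    refine squeeze_zero (fun m => (hpos m).le) (fun m => ?_) h1
    have := (ha.avgLength_pos (N m)).le
    rw [mul_assoc]
    refine mul_le_mul_of_nonneg_left (mul_le_mul_of_nonneg_right ?_ this) hc.le
    exact pow_le_pow_right₀ one_le_two (hN m)
  refine ⟨hlim, ?_, ?_⟩
  · have h1 : ∀ m, c * 2 ^ m * avgLength a (N m) / avgLength a (N m) = c * 2 ^ m := fun m =>
      mul_div_cancel_right₀ _ (ha.avgLength_pos _).ne'
    simp only [h1]
    exact (tendsto_pow_atTop_atTop_of_one_lt one_lt_two).const_mul_atTop hc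
  · -- after taking logarithms the claim is `Φ(R) |log R| ≤ log (c 2 ^ m)`; the left side is at most
    -- `(1 / 4) log |log R|`, which is `(m / 2) log 2` up to a constant since `|log R| = O(4 ^ m)`
    obtain ⟨A, B, hA, hB, hlog⟩ := ha.exists_log_bounds
    have hK : 0 < |Real.log c| + 2 * B := by positivity
    have hl2 : 0 < Real.log 2 := Real.log_pos one_lt_two
    have hlin : ∀ᶠ m : ℕ in atTop, (Real.log (|Real.log c| + 2 * B) / 4 - Real.log c) /
        (Real.log 2 / 2) ≤ m := tendsto_natCast_atTop_atTop.eventually_ge_atTop _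
    filter_upwards [hlim.eventually ((isLittleO_logLog_iff hΦ).1 h (1 / 4) (by norm_num)),
      hlim.eventually (eventually_nhdsWithin_of_eventually_nhds (gt_mem_nhds one_pos)), hlin]
      with m h1 h2 h3
    have hs := ha.avgLength_pos (N m)
    have hR := hpos m
    have hlogR : Real.log (c * 2 ^ m * avgLength a (N m)) =
        Real.log c + m * Real.log 2 + Real.log (avgLength a (N m)) := by
      rw [Real.log_mul (by positivity) hs.ne', Real.log_mul hc.ne' (by positivity), Real.log_pow]
    set R := c * 2 ^ m * avgLength a (N m) with hRdef
    have hneg : Real.log R < 0 := Real.log_neg hR h2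
    rw [abs_of_neg hneg] at h1
    have h4 := (hlog 0 (N m)).2
    rw [zero_add, ha.avgLength_zero, Real.log_one] at h4
    have h5 : (N m : ℝ) ≤ 2 * 4 ^ m := by exact_mod_cast hN' m
    have h6 : -Real.log R ≤ (|Real.log c| + 2 * B) * 4 ^ m := by
      have h7 : (N m : ℝ) * B ≤ 2 * 4 ^ m * B := by gcongr
      have h8 : |Real.log c| ≤ |Real.log c| * 4 ^ m :=
        le_mul_of_one_le_right (abs_nonneg _) (one_le_pow₀ (by norm_num))
      have h9 : 0 ≤ m * Real.log 2 := by positivity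
      linarith [neg_abs_le (Real.log c)]
    have h7 : Real.log (-Real.log R) ≤
        Real.log (|Real.log c| + 2 * B) + m * (2 * Real.log 2) := by
      have h8 : Real.log 4 = 2 * Real.log 2 := by
        rw [← Real.log_rpow two_pos]
        norm_num
      rw [← h8, ← Real.log_pow, ← Real.log_mul hK.ne' (by positivity)]
      exact Real.log_le_log (neg_pos.2 hneg) h6
    rw [div_le_iff₀ (by positivity)] at h3
    rw [← Real.log_le_log_iff hs (Real.rpow_pos_of_pos hR _), Real.log_rpow hR]
    linarith

/-! ### The decreasing set -/

theorem sum_from_eq_add {a : ℕ+ → ℝ} (h0 : ∀ j, 0 ≤ a j) (hs : Summable a) (k : ℕ+) :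
    (∑' i : ℕ+, if k ≤ i then a i else 0) =
      (∑' i : ℕ+, if k + 1 ≤ i then a i else 0) + a k := by
  refine ((((summable_ite h0 hs _).hasSum).add (hasSum_ite_self a k)).congr_fun ?_).tsum_eq
  intro i
  rcases lt_trichotomy i k with h | h | h
  · have h3 : ¬ k + 1 ≤ i := fun h' => (not_le.2 h) ((PNat.lt_add_right k 1).le.trans h')
    simp [not_le.2 h, h3, h.ne]
  · subst h
    simp
  · simp [h.le, h.ne', PNat.add_one_le_iff.2 h]

/-- Below its point `∑_{i ≥ k} a_i` the decreasing set has no holes larger than `a_k`. -/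
theorem exists_mem_decreasingSet {a : ℕ+ → ℝ} (h0 : ∀ j, 0 ≤ a j) (ha : Antitone a)
    (hs : Summable a) (k : ℕ+) {y : ℝ}
    (hy : y ∈ Icc 0 (∑' i : ℕ+, if k ≤ i then a i else 0)) :
    ∃ z ∈ decreasingSet a, 0 ≤ z ∧ z ≤ y ∧ y - z ≤ a k := by
  set t : ℕ+ → ℝ := fun k => ∑' i : ℕ+, if k ≤ i then a i else 0 with ht
  have hstep : ∀ k, t k = t (k + 1) + a k := sum_from_eq_add h0 hs
  have hnn : ∀ k, 0 ≤ t k := fun k => tsum_nonneg fun i => by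
    split_ifs
    exacts [h0 i, le_rfl]
  have hanti : Antitone t := fun k l hkl => by
    refine (summable_ite h0 hs _).tsum_le_tsum (fun i => ?_) (summable_ite h0 hs _)
    by_cases h : l ≤ i
    · simp [h, hkl.trans h]
    · simp only [h, if_false]
      split_ifs
      exacts [h0 i, le_rfl]
  rcases hy.1.eq_or_lt with h | hpos
  · exact ⟨0, mem_insert _ _, le_rfl, hy.1, by rw [← h, sub_zero]; exact h0 k⟩
  -- if `y` were far above every smaller point, it could not pass any of them
  by_contra! hcon
  have hall : ∀ j, k ≤ j → y ≤ t j := by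
    intro j
    induction j using PNat.recOn with
    | one =>
      intro hk
      have : k = 1 := le_antisymm hk one_le
      exact this ▸ hy.2
    | succ j ih =>
      intro hk
      rcases hk.eq_or_lt with hk | hk
      · exact hk ▸ hy.2
      · have hkj : k ≤ j := PNat.lt_add_one_iff.1 hk
        by_contra! hlt
        have h1 := hcon (t (j + 1)) (mem_insert_of_mem _ ⟨j + 1, rfl⟩) (hnn _) hlt.le
        have h2 := ih hkj
        rw [hstep j] at h2
        linarith [ha hkj]
  have hlim : Tendsto t atTop (𝓝 0) := tendsto_tail a
  obtain ⟨j, hj, hjk⟩ := ((hlim.eventually (gt_mem_nhds hpos)).and (eventually_ge_atTop k)).exists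
  exact absurd (hall j hjk) (not_le.2 hj)

theorem one_le_upperPhiDim_decreasingSet {a : ℕ+ → ℝ} (ha : IsLevelComparable a) {Φ : ℝ → ℝ}
    (hΦ : IsDimensionFunction Φ)
    (h : Φ =o[𝓝[>] 0] fun x : ℝ => Real.log |Real.log x| / |Real.log x|) :
    1 ≤ upperPhiDim Φ (decreasingSet a) := by
  obtain ⟨C, hC, hCa⟩ := ha.exists_le_mul_avgLength
  obtain ⟨h1, h2, h3⟩ := scales_admissible ha hΦ h one_pos (N := id) (fun m => le_rfl)
    (fun m => ((Nat.lt_pow_self (by norm_num)).le.trans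
      (Nat.le_mul_of_pos_left _ two_pos) : m ≤ 2 * 4 ^ m))
  refine one_le_upperPhiDim hC.le (fun m => ha.avgLength_pos _) h1 h2 h3
    (Eventually.of_forall fun m => ⟨0, mem_insert _ _, fun y hy => ?_⟩)
  have h4 : ∀ j : ℕ+, (2 : ℕ+) ^ m ≤ j ↔ 2 ^ m ≤ (j : ℕ) := fun j => by
    rw [← PNat.coe_le_coe, PNat.pow_coe]
    rfl
  obtain ⟨z, hz, hz0, hzy, hyz⟩ := exists_mem_decreasingSet ha.nonneg ha.anti ha.hasSum.summable
    (2 ^ m) (y := y) (by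
      simp only [h4]
      rw [← two_pow_mul_avgLength]
      simpa using hy)
  exact ⟨z, hz, hz0, hzy, hyz.trans (hCa m)⟩

/-! ### Intervals of the set of an order that avoid the long gaps -/

theorem sum_lower_le_gapLeft {a : ℕ+ → ℝ} (h0 : ∀ j, 0 ≤ a j) (hs : Summable a)
    (o : TotalOrder ℕ+) (p : ℕ+ → Prop) [DecidablePred p] (hp : ∀ i j, o.lt j i → p i → p j)
    {i : ℕ+} (hi : ¬ p i) : (∑' j, if p j then a j else 0) ≤ gapLeft a o i := by
  classical
  refine (summable_ite h0 hs p).tsum_le_tsum (fun j => ?_) (summable_ite h0 hs _)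
  by_cases h : p j
  · have hji : o.lt j i := (o.total j i (by rintro rfl; exact hi h)).resolve_right
      fun h' => hi (hp _ _ h' h)
    simp [h, hji]
  · simp only [h, if_false]
    split_ifs
    exacts [h0 j, le_rfl]

theorem sum_lower_mem_orderedSet {a : ℕ+ → ℝ} (h0 : ∀ j, 0 ≤ a j) (hs : Summable a)
    (o : TotalOrder ℕ+) (p : ℕ+ → Prop) [DecidablePred p] (hp : ∀ i j, o.lt j i → p i → p j) :
    (∑' j, if p j then a j else 0) ∈ orderedSet a o := by
  refine ⟨⟨tsum_nonneg fun j => ?_, (summable_ite h0 hs p).tsum_le_tsum (fun j => ?_) hs⟩, ?_⟩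
  · split_ifs
    exacts [h0 j, le_rfl]
  · split_ifs
    exacts [le_rfl, h0 j]
  · simp only [mem_iUnion, not_exists]
    intro i hi
    by_cases h : p i
    · exact absurd hi.2 (not_lt.2 (gapLeft_add_le h0 hs o i p h fun j hj => hp _ _ hj h))
    · exact absurd hi.1 (not_lt.2 (sum_lower_le_gapLeft h0 hs o p hp h))

/-- If `p` and `q` are initial segments of the order and the gaps in `q` but not in `p` have length
at most `g`, then the set of the order has no holes larger than `g` between the points
that correspond to `p` and `q`. -/
theorem exists_mem_orderedSet {a : ℕ+ → ℝ} (h0 : ∀ j, 0 ≤ a j) (hs : Summable a)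
    (o : TotalOrder ℕ+) (p q : ℕ+ → Prop) [DecidablePred p] [DecidablePred q]
    (hp : ∀ i j, o.lt j i → p i → p j) (hq : ∀ i j, o.lt j i → q i → q j) {g : ℝ} (hg : 0 ≤ g)
    (hpq : ∀ i, q i → ¬ p i → a i ≤ g) {y : ℝ}
    (hy : y ∈ Icc (∑' j, if p j then a j else 0) (∑' j, if q j then a j else 0)) :
    ∃ z ∈ orderedSet a o, (∑' j, if p j then a j else 0) ≤ z ∧ z ≤ y ∧ y - z ≤ g := by
  classical
  by_cases hyE : y ∈ orderedSet a o
  · exact ⟨y, hyE, hy.1, le_rfl, by rwa [sub_self]⟩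
  · have hy01 : y ∈ Icc 0 (∑' i, a i) :=
      ⟨(sum_lower_mem_orderedSet h0 hs o p hp).1.1.trans hy.1,
        hy.2.trans (sum_lower_mem_orderedSet h0 hs o q hq).1.2⟩
    have hgap : y ∈ ⋃ i, Ioo (gapLeft a o i) (gapLeft a o i + a i) := by
      by_contra h
      exact hyE ⟨hy01, h⟩
    obtain ⟨i, hi⟩ := mem_iUnion.1 hgap
    have hpi : ¬ p i := fun h => absurd (hi.2.trans_le
      (gapLeft_add_le h0 hs o i p h fun j hj => hp _ _ hj h)) (not_lt.2 hy.1)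
    have hqi : q i := by
      by_contra h
      exact absurd ((sum_lower_le_gapLeft h0 hs o q hq h).trans_lt hi.1) (not_lt.2 hy.2)
    refine ⟨gapLeft a o i, ?_, sum_lower_le_gapLeft h0 hs o p hp hpi, hi.1.le, ?_⟩
    · exact sum_lower_mem_orderedSet h0 hs o (fun j => o.lt j i)
        fun k j hjk hki => o.trans _ _ _ hjk hki
    · linarith [hi.2, hpq i hqi hpi]

/-- The order `o` *isolates* a set of more than `M` indices from `S` with respect to `B` if no
index in `B` lies between two indices of that set. -/
def isolatedRun (B S : Finset ℕ+) (M : ℝ) : Set (TotalOrder ℕ+) :=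
  {o | ∃ T ∈ S.powerset, M < (T.card : ℝ) ∧
    ∀ i ∈ T, ∀ j ∈ T, ∀ b ∈ B, ¬ (o.lt i b ∧ o.lt b j)}

/-- An isolated run produces a long interval of the ordered set that meets only short gaps. -/
theorem exists_interval_of_isolatedRun {a : ℕ+ → ℝ} (h0 : ∀ j, 0 ≤ a j) (hs : Summable a)
    {B S : Finset ℕ+} {M ℓ g : ℝ} (hM : 0 ≤ M) (hg : 0 ≤ g) (hℓ : 0 ≤ ℓ)
    (hSℓ : ∀ i ∈ S, ℓ ≤ a i) (hB : ∀ i, i ∉ B → a i ≤ g) (hBS : Disjoint B S)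
    {o : TotalOrder ℕ+} (ho : o ∈ isolatedRun B S M) :
    ∃ x ∈ orderedSet a o, ∀ y ∈ Icc x (x + M * ℓ), ∃ z ∈ orderedSet a o,
      x ≤ z ∧ z ≤ y ∧ y - z ≤ g := by
  classical
  obtain ⟨T, hTS, hcard, hT⟩ := ho
  rw [Finset.mem_powerset] at hTS
  have hTne : T.Nonempty := by
    rw [← Finset.card_pos]
    exact_mod_cast hM.trans_lt hcard
  -- the indices that precede all of `T`, and those that do not follow all of `T`
  let p : ℕ+ → Prop := fun l => ∀ i ∈ T, o.lt l i
  let q : ℕ+ → Prop := fun l => ∃ i ∈ T, l = i ∨ o.lt l i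
  have hp : ∀ i j, o.lt j i → p i → p j := fun i j hji hi l hl => o.trans _ _ _ hji (hi l hl)
  have hq : ∀ i j, o.lt j i → q i → q j := by
    rintro i j hji ⟨l, hl, rfl | hil⟩
    · exact ⟨i, hl, Or.inr hji⟩
    · exact ⟨l, hl, Or.inr (o.trans _ _ _ hji hil)⟩
  have hpq : ∀ i, q i → ¬ p i → a i ≤ g := by
    rintro l ⟨j, hj, hlj⟩ hpl
    refine hB l fun hlB => ?_
    have hlT : l ∉ T := fun h => Finset.disjoint_left.1 hBS hlB (hTS h)
    obtain ⟨i, hi, hli⟩ : ∃ i ∈ T, ¬ o.lt l i := by simpa [p] using hpl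
    have hne : ∀ {k}, k ∈ T → l ≠ k := fun hk h => hlT (h ▸ hk)
    exact hT i hi j hj l hlB ⟨(o.total l i (hne hi)).resolve_left hli, hlj.resolve_left (hne hj)⟩
  have hlen : (∑' j, if p j then a j else 0) + M * ℓ ≤ ∑' j, if q j then a j else 0 := by
    have h1 : HasSum (fun j => if j ∈ T then a j else 0) (∑ j ∈ T, a j) := by
      have := hasSum_sum_of_ne_finset_zero (L := .unconditional ℕ+) (s := T)
        (f := fun j => if j ∈ T then a j else 0) (fun j hj => if_neg hj)
      rwa [Finset.sum_congr rfl fun j hj => if_pos hj] at this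
    have h2 : M * ℓ ≤ ∑ j ∈ T, a j := by
      have := Finset.card_nsmul_le_sum T a ℓ fun j hj => hSℓ j (hTS hj)
      rw [nsmul_eq_mul] at this
      exact (mul_le_mul_of_nonneg_right hcard.le hℓ).trans this
    refine (add_le_add_right h2 _).trans
      (hasSum_le (fun j => ?_) ((summable_ite h0 hs p).hasSum.add h1)
        (summable_ite h0 hs q).hasSum)
    by_cases hj : j ∈ T
    · have h3 : ¬ p j := fun h => o.irrefl j (h j hj)
      have h4 : q j := ⟨j, hj, Or.inl rfl⟩
      simp [hj, h3, h4]
    · by_cases hpj : p j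
      · obtain ⟨i, hi⟩ := hTne
        have h4 : q j := ⟨i, hi, Or.inr (hpj i hi)⟩
        simp [hj, hpj, h4]
      · simp only [hj, hpj, if_false, add_zero]
        split_ifs
        exacts [h0 j, le_rfl]
  exact ⟨_, sum_lower_mem_orderedSet h0 hs o p hp, fun y hy =>
    exists_mem_orderedSet h0 hs o p q hp hq hg hpq ⟨hy.1, hy.2.trans hlen⟩⟩

/-! ### Empty boxes in an independent sample -/

section Boxes

variable {ι κ 𝓧 : Type*}

/-- The indicator that no sample point with index in `B` falls in `A`. -/
noncomputable def avoids (A : Set 𝓧) (B : Finset ι) (ω : ι → 𝓧) : ℝ :=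
  ∏ i ∈ B, (1 - A.indicator (fun _ => (1 : ℝ)) (ω i))

/-- The number of sample points with index in `S` that fall in `A`, minus `M`. -/
noncomputable def surplus (A : Set 𝓧) (S : Finset ι) (M : ℝ) (ω : ι → 𝓧) : ℝ :=
  ∑ i ∈ S, A.indicator (fun _ => (1 : ℝ)) (ω i) - M

theorem indicator_one_mem_Icc (A : Set 𝓧) (x : 𝓧) :
    A.indicator (fun _ => (1 : ℝ)) x ∈ Icc (0 : ℝ) 1 := by
  by_cases h : x ∈ A <;> simp [h]

theorem avoids_mem_Icc (A : Set 𝓧) (B : Finset ι) (ω : ι → 𝓧) :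
    avoids A B ω ∈ Icc (0 : ℝ) 1 :=
  ⟨Finset.prod_nonneg fun i _ => by linarith [(indicator_one_mem_Icc A (ω i)).2],
    Finset.prod_le_one (fun i _ => by linarith [(indicator_one_mem_Icc A (ω i)).2])
      fun i _ => by linarith [(indicator_one_mem_Icc A (ω i)).1]⟩

theorem abs_surplus_le (A : Set 𝓧) (S : Finset ι) {M : ℝ} (hM : 0 ≤ M) (ω : ι → 𝓧) :
    |surplus A S M ω| ≤ S.card + M := by
  have h1 : ∑ i ∈ S, A.indicator (fun _ => (1 : ℝ)) (ω i) ≤ S.card := by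
    have := Finset.sum_le_card_nsmul S (fun i => A.indicator (fun _ => (1 : ℝ)) (ω i)) 1
      fun i _ => (indicator_one_mem_Icc A (ω i)).2
    simpa using this
  have h2 : 0 ≤ ∑ i ∈ S, A.indicator (fun _ => (1 : ℝ)) (ω i) :=
    Finset.sum_nonneg fun i _ => (indicator_one_mem_Icc A (ω i)).1
  rw [surplus, abs_le]
  constructor <;> linarith

variable [MeasurableSpace 𝓧]

theorem measurable_indicator_one {A : Set 𝓧} (hA : MeasurableSet A) :
    Measurable (A.indicator fun _ => (1 : ℝ)) :=
  measurable_const.indicator hA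

theorem measurable_avoids {A : Set 𝓧} (hA : MeasurableSet A) (B : Finset ι) :
    Measurable (avoids A B) := by
  unfold avoids
  exact Finset.measurable_fun_prod _ fun i _ =>
    measurable_const.sub ((measurable_indicator_one hA).comp (measurable_pi_apply i))

theorem measurable_surplus {A : Set 𝓧} (hA : MeasurableSet A) (S : Finset ι) (M : ℝ) :
    Measurable (surplus A S M) := by
  unfold surplus
  exact (Finset.measurable_fun_sum _ fun i _ =>
    (measurable_indicator_one hA).comp (measurable_pi_apply i)).sub measurable_const

variable (ν : Measure 𝓧) [IsProbabilityMeasure ν]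

theorem integral_eval_infinitePi (i : ι) {f : 𝓧 → ℝ} (hf : Measurable f) :
    ∫ ω, f (ω i) ∂(Measure.infinitePi fun _ : ι => ν) = ∫ x, f x ∂ν := by
  conv_rhs => rw [← Measure.infinitePi_map_eval (fun _ : ι => ν) i]
  rw [integral_map (measurable_pi_apply i).aemeasurable hf.aestronglyMeasurable]

theorem integral_prod_infinitePi (F : Finset ι) {f : 𝓧 → ℝ} (hf : Measurable f) :
    ∫ ω, ∏ i ∈ F, f (ω i) ∂(Measure.infinitePi fun _ : ι => ν) = (∫ x, f x ∂ν) ^ F.card := by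
  have hind : ProbabilityTheory.iIndepFun (fun (i : F) (ω : ι → 𝓧) => ω i)
      (Measure.infinitePi fun _ : ι => ν) :=
    (ProbabilityTheory.iIndepFun_infinitePi (X := fun (_ : ι) (x : 𝓧) => x)
      (fun _ => measurable_id)).precomp Subtype.val_injective
  have h := hind.integral_fun_prod_comp (f := fun _ => f) (fun i => (measurable_pi_apply (i : ι)).aemeasurable)
    (fun i => hf.aestronglyMeasurable)
  simp only [integral_eval_infinitePi ν _ hf, Finset.prod_const, Finset.card_univ,
    Fintype.card_coe] at h
  rw [← h]
  exact integral_congr_ae (Eventually.of_forall fun ω =>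
    (Finset.prod_coe_sort F fun i => f (ω i)).symm)

theorem integral_indicator_mul_indicator {A A' : Set 𝓧} (hA : MeasurableSet A)
    (hA' : MeasurableSet A') {i j : ι} (hij : i ≠ j) :
    ∫ ω, A.indicator (fun _ => (1 : ℝ)) (ω i) * A'.indicator (fun _ => (1 : ℝ)) (ω j)
      ∂(Measure.infinitePi fun _ : ι => ν) = ν.real A * ν.real A' := by
  have hind := (ProbabilityTheory.iIndepFun_infinitePi (P := fun _ : ι => ν)
    (X := fun (_ : ι) (x : 𝓧) => x) (fun _ => measurable_id)).indepFun hij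
  rw [hind.integral_fun_comp_mul_comp (measurable_pi_apply i).aemeasurable
    (measurable_pi_apply j).aemeasurable (measurable_indicator_one hA).aestronglyMeasurable
    (measurable_indicator_one hA').aestronglyMeasurable,
    integral_eval_infinitePi ν i (measurable_indicator_one hA),
    integral_eval_infinitePi ν j (measurable_indicator_one hA')]
  congr 1
  · exact integral_indicator_one hA
  · exact integral_indicator_one hA'

theorem integrable_of_abs_le {Ω : Type*} [MeasurableSpace Ω] {P : Measure Ω} [IsFiniteMeasure P]
    {f : Ω → ℝ} (hf : Measurable f) {C : ℝ} (h : ∀ ω, |f ω| ≤ C) : Integrable f P :=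
  .of_bound hf.aestronglyMeasurable C (Eventually.of_forall h)

theorem integral_one_sub_indicator {A : Set 𝓧} (hA : MeasurableSet A) :
    ∫ x, (1 - A.indicator (fun _ => (1 : ℝ)) x) ∂ν = 1 - ν.real A := by
  have h1 : Integrable (fun x => A.indicator (fun _ => (1 : ℝ)) x) ν :=
    (integrable_const (1 : ℝ)).indicator hA
  have h2 : ∫ x, A.indicator (fun _ => (1 : ℝ)) x ∂ν = ν.real A := integral_indicator_one hA
  rw [integral_sub (integrable_const _) h1, h2]
  simp

theorem integral_avoids {A : Set 𝓧} (hA : MeasurableSet A) (B : Finset ι) :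
    ∫ ω, avoids A B ω ∂(Measure.infinitePi fun _ : ι => ν) = (1 - ν.real A) ^ B.card := by
  have hm := measurable_indicator_one hA
  unfold avoids
  rw [integral_prod_infinitePi ν B (f := fun x => 1 - A.indicator (fun _ => (1 : ℝ)) x)
    (measurable_const.sub hm), integral_one_sub_indicator ν hA]

/-- Emptiness of disjoint boxes is negatively correlated. -/
theorem integral_avoids_mul_le {A A' : Set 𝓧} (hA : MeasurableSet A) (hA' : MeasurableSet A')
    (hd : Disjoint A A') (B : Finset ι) :
    ∫ ω, avoids A B ω * avoids A' B ω ∂(Measure.infinitePi fun _ : ι => ν) ≤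
      (1 - ν.real A) ^ B.card * (1 - ν.real A') ^ B.card := by
  set g : 𝓧 → ℝ := fun x =>
    (1 - A.indicator (fun _ => (1 : ℝ)) x) * (1 - A'.indicator (fun _ => (1 : ℝ)) x) with hg
  have hgm : Measurable g := (measurable_const.sub (measurable_indicator_one hA)).mul
    (measurable_const.sub (measurable_indicator_one hA'))
  have hg' : ∀ x, g x =
      1 - A.indicator (fun _ => (1 : ℝ)) x - A'.indicator (fun _ => (1 : ℝ)) x := by
    intro x
    by_cases h : x ∈ A
    · simp [hg, h, Set.disjoint_left.1 hd h]
    · simp [hg, h]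
  have hint : ∫ x, g x ∂ν = 1 - ν.real A - ν.real A' := by
    simp only [hg']
    have h1 : Integrable (fun x => 1 - A.indicator (fun _ => (1 : ℝ)) x) ν :=
      (integrable_const (1 : ℝ)).sub ((integrable_const (1 : ℝ)).indicator hA)
    have h2 : Integrable (fun x => A'.indicator (fun _ => (1 : ℝ)) x) ν :=
      (integrable_const (1 : ℝ)).indicator hA'
    have h3 : ∫ x, A'.indicator (fun _ => (1 : ℝ)) x ∂ν = ν.real A' := integral_indicator_one hA'
    rw [integral_sub h1 h2, integral_one_sub_indicator ν hA, h3]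
  have hnn : 0 ≤ ∫ x, g x ∂ν := integral_nonneg fun x => mul_nonneg
    (by linarith [(indicator_one_mem_Icc A x).2]) (by linarith [(indicator_one_mem_Icc A' x).2])
  have h1 : ∀ ω : ι → 𝓧, avoids A B ω * avoids A' B ω = ∏ i ∈ B, g (ω i) := fun ω =>
    Finset.prod_mul_distrib.symm
  simp only [h1]
  rw [integral_prod_infinitePi ν B hgm, ← mul_pow]
  refine pow_le_pow_left₀ hnn ?_ _
  rw [hint]
  nlinarith [mul_nonneg (measureReal_nonneg (μ := ν) (s := A))
    (measureReal_nonneg (μ := ν) (s := A'))]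

theorem integral_surplus {A : Set 𝓧} (hA : MeasurableSet A) (S : Finset ι) (M : ℝ) :
    ∫ ω, surplus A S M ω ∂(Measure.infinitePi fun _ : ι => ν) = S.card * ν.real A - M := by
  have hint : ∀ i ∈ S, Integrable (fun ω : ι → 𝓧 => A.indicator (fun _ => (1 : ℝ)) (ω i))
      (Measure.infinitePi fun _ : ι => ν) := fun i _ =>
    integrable_of_abs_le (C := 1) ((measurable_indicator_one hA).comp (measurable_pi_apply i))
      fun ω => abs_le.2 ⟨by linarith [(indicator_one_mem_Icc A (ω i)).1],
        (indicator_one_mem_Icc A (ω i)).2⟩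
  unfold surplus
  rw [integral_sub (integrable_finsetSum _ hint) (integrable_const _), integral_finsetSum _ hint]
  simp only [integral_eval_infinitePi ν _ (measurable_indicator_one hA)]
  have h1 : ∫ x, A.indicator (fun _ => (1 : ℝ)) x ∂ν = ν.real A := integral_indicator_one hA
  simp [h1]

/-- The mixed second moments of the counts of sample points in boxes of mass `q`: the boxes are
equal or disjoint, and `δ` is `1` or `0` accordingly. -/
theorem integral_surplus_mul_le {A A' : Set 𝓧} (hA : MeasurableSet A) (hA' : MeasurableSet A')
    {q δ : ℝ} (hq : ν.real A = q) (hq' : ν.real A' = q) (hδ : ν.real (A ∩ A') ≤ δ * q)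
    (S : Finset ι) (M : ℝ) :
    ∫ ω, surplus A S M ω * surplus A' S M ω ∂(Measure.infinitePi fun _ : ι => ν) ≤
      (S.card * q - M) ^ 2 + δ * (S.card * q) := by
  classical
  set P := Measure.infinitePi fun _ : ι => ν with hP
  have hm : ∀ {A : Set 𝓧}, MeasurableSet A → ∀ i : ι,
      Measurable fun ω : ι → 𝓧 => A.indicator (fun _ => (1 : ℝ)) (ω i) := fun hA i =>
    (measurable_indicator_one hA).comp (measurable_pi_apply i)
  have hmul : ∀ i j : ι, Integrable (fun ω : ι → 𝓧 =>
      A.indicator (fun _ => (1 : ℝ)) (ω i) * A'.indicator (fun _ => (1 : ℝ)) (ω j)) P := by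
    intro i j
    refine integrable_of_abs_le (C := 1) ((hm hA i).mul (hm hA' j)) fun ω => ?_
    have h1 := indicator_one_mem_Icc A (ω i)
    have h2 := indicator_one_mem_Icc A' (ω j)
    rw [abs_of_nonneg (mul_nonneg h1.1 h2.1)]
    exact mul_le_one₀ h1.2 h2.1 h2.2
  have hsum : ∀ {A : Set 𝓧}, MeasurableSet A → Integrable (surplus A S 0) P := fun hA =>
    integrable_of_abs_le (measurable_surplus hA S 0) (abs_surplus_le _ S le_rfl)
  have hprod : Integrable (fun ω => surplus A S 0 ω * surplus A' S 0 ω) P := by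
    simp only [surplus, sub_zero, Finset.sum_mul_sum]
    exact integrable_finsetSum _ fun i _ => integrable_finsetSum _ fun j _ => hmul i j
  have hcount : ∫ ω, surplus A S 0 ω * surplus A' S 0 ω ∂P ≤
      (S.card * q) ^ 2 + δ * (S.card * q) := by
    have h1 : ∀ i j : ι, ∫ ω, A.indicator (fun _ => (1 : ℝ)) (ω i) *
        A'.indicator (fun _ => (1 : ℝ)) (ω j) ∂P ≤ q ^ 2 + if i = j then δ * q else 0 := by
      intro i j
      by_cases hij : i = j
      · subst hij
        have h2 : ∀ ω : ι → 𝓧, A.indicator (fun _ => (1 : ℝ)) (ω i) *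
            A'.indicator (fun _ => (1 : ℝ)) (ω i) =
            (A ∩ A').indicator (fun _ => (1 : ℝ)) (ω i) := fun ω => by
          by_cases h : ω i ∈ A <;> by_cases h' : ω i ∈ A' <;> simp [h, h']
        simp only [h2]
        rw [integral_eval_infinitePi ν i (measurable_indicator_one (hA.inter hA'))]
        have h3 : ∫ x, (A ∩ A').indicator (fun _ => (1 : ℝ)) x ∂ν = ν.real (A ∩ A') :=
          integral_indicator_one (hA.inter hA')
        simp only [if_true, h3]
        nlinarith [sq_nonneg q]
      · rw [integral_indicator_mul_indicator ν hA hA' hij, hq, hq', if_neg hij]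
        linarith
    simp only [surplus, sub_zero, Finset.sum_mul_sum]
    rw [integral_finsetSum _ fun i _ => integrable_finsetSum _ fun j _ => hmul i j]
    calc ∑ i ∈ S, ∫ ω, ∑ j ∈ S, A.indicator (fun _ => (1 : ℝ)) (ω i) *
          A'.indicator (fun _ => (1 : ℝ)) (ω j) ∂P
        ≤ ∑ i ∈ S, ∑ j ∈ S, (q ^ 2 + if i = j then δ * q else 0) := by
          refine Finset.sum_le_sum fun i _ => ?_
          rw [integral_finsetSum _ fun j _ => hmul i j]
          exact Finset.sum_le_sum fun j _ => h1 i j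
      _ = _ := by
          simp only [Finset.sum_add_distrib, Finset.sum_const, Finset.sum_ite_eq, nsmul_eq_mul]
          rw [Finset.sum_congr rfl fun i hi => if_pos hi]
          simp only [Finset.sum_const, nsmul_eq_mul]
          ring
  have hexp : ∀ ω, surplus A S M ω * surplus A' S M ω =
      surplus A S 0 ω * surplus A' S 0 ω - M * surplus A S 0 ω - M * surplus A' S 0 ω + M ^ 2 := by
    intro ω
    simp only [surplus]
    ring
  simp only [hexp]
  have hi1 : Integrable (fun ω => surplus A S 0 ω * surplus A' S 0 ω - M * surplus A S 0 ω) P :=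
    hprod.sub ((hsum hA).const_mul M)
  have hi2 : Integrable (fun ω => surplus A S 0 ω * surplus A' S 0 ω - M * surplus A S 0 ω -
      M * surplus A' S 0 ω) P := hi1.sub ((hsum hA').const_mul M)
  rw [integral_add hi2 (integrable_const _), integral_sub hi1 ((hsum hA').const_mul M),
    integral_sub hprod ((hsum hA).const_mul M), integral_const_mul, integral_const_mul,
    integral_surplus ν hA, integral_surplus ν hA', hq, hq', integral_const, probReal_univ,
    one_smul]
  linarith

theorem indepFun_restrict_infinitePi {B S : Finset ι} (hBS : Disjoint B S) :
    ProbabilityTheory.IndepFun (fun (ω : ι → 𝓧) (i : B) => ω i)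
      (fun (ω : ι → 𝓧) (i : S) => ω i) (Measure.infinitePi fun _ : ι => ν) :=
  (ProbabilityTheory.iIndepFun_infinitePi (P := fun _ : ι => ν)
    (X := fun (_ : ι) (x : 𝓧) => x) (fun _ => measurable_id)).indepFun_finset B S hBS
      fun i => measurable_pi_apply i

/-- The second moment method for the occupancy problem. Throw the points with index in `B ∪ S`
into disjoint boxes of mass `q`; it is unlikely that every box without a point of `B` contains at
most `M` points of `S`, where `M` is below the expected number. The test variable is the sum over
the empty boxes of the surplus: its variance is controlled by the diagonal terms because distinct
boxes are negatively correlated. -/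
theorem measure_forall_box_le [Fintype κ] [Nonempty κ] {I : κ → Set 𝓧}
    (hI : ∀ k, MeasurableSet (I k)) (hd : Pairwise (Function.onFun Disjoint I)) {q : ℝ}
    (hq : ∀ k, ν.real (I k) = q) (hq1 : q < 1) {B S : Finset ι} (hBS : Disjoint B S) {M : ℝ}
    (hM : 0 ≤ M) (hMS : M < S.card * q) :
    (Measure.infinitePi fun _ : ι => ν)
        {ω | ∀ k, avoids (I k) B ω * surplus (I k) S M ω ≤ 0} ≤
      ENNReal.ofReal (((S.card * q - M) ^ 2 + S.card * q) /
        (Fintype.card κ * (1 - q) ^ B.card * (S.card * q - M) ^ 2)) := by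
  classical
  set P := Measure.infinitePi fun _ : ι => ν with hP
  set c := S.card * q - M with hc
  set p := (1 - q) ^ B.card with hp
  have hc0 : 0 < c := sub_pos.2 hMS
  have hp0 : 0 < p := pow_pos (by linarith) _
  have hQ : (0 : ℝ) < Fintype.card κ := by exact_mod_cast Fintype.card_pos
  set W : (ι → 𝓧) → ℝ := fun ω => ∑ k, avoids (I k) B ω * surplus (I k) S M ω with hW
  have hXm := fun k => measurable_avoids (hI k) B
  have hVm := fun k => measurable_surplus (hI k) S M
  have hXVbound : ∀ k ω, |avoids (I k) B ω * surplus (I k) S M ω| ≤ S.card + M := by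
    intro k ω
    have h1 := avoids_mem_Icc (I k) B ω
    have h2 := abs_surplus_le (I k) S hM ω
    rw [abs_mul, abs_of_nonneg h1.1]
    exact (mul_le_of_le_one_left (abs_nonneg _) h1.2).trans h2
  have hXV : ∀ k, Integrable (fun ω => avoids (I k) B ω * surplus (I k) S M ω) P := fun k =>
    integrable_of_abs_le ((hXm k).mul (hVm k)) (hXVbound k)
  have hXVXV : ∀ j k, Integrable (fun ω => avoids (I j) B ω * surplus (I j) S M ω *
      (avoids (I k) B ω * surplus (I k) S M ω)) P := fun j k =>
    integrable_of_abs_le (C := (S.card + M) * (S.card + M))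
      (((hXm j).mul (hVm j)).mul ((hXm k).mul (hVm k))) fun ω => by
        rw [abs_mul]
        exact mul_le_mul (hXVbound j ω) (hXVbound k ω) (abs_nonneg _) (by positivity)
  -- the points of `B` and those of `S` are independent
  have hind := indepFun_restrict_infinitePi ν hBS
  have hrm : ∀ F : Finset ι, Measurable fun (ω : ι → 𝓧) (i : F) => ω i := fun F =>
    measurable_pi_lambda _ fun i => measurable_pi_apply _
  -- `avoids` and `surplus` as functions of the restricted samples
  let X' : κ → (B → 𝓧) → ℝ := fun k x =>
    ∏ i : B, (1 - (I k).indicator (fun _ => (1 : ℝ)) (x i))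
  let V' : κ → (S → 𝓧) → ℝ := fun k x =>
    ∑ i : S, (I k).indicator (fun _ => (1 : ℝ)) (x i) - M
  have hX'm : ∀ k, Measurable (X' k) := fun k => Finset.measurable_fun_prod _ fun i _ =>
    measurable_const.sub ((measurable_indicator_one (hI k)).comp (measurable_pi_apply i))
  have hV'm : ∀ k, Measurable (V' k) := fun k => (Finset.measurable_fun_sum _ fun i _ =>
    (measurable_indicator_one (hI k)).comp (measurable_pi_apply i)).sub measurable_const
  have hX' : ∀ k ω, avoids (I k) B ω = X' k fun i => ω i := fun k ω =>
    (Finset.prod_coe_sort B fun i => 1 - (I k).indicator (fun _ => (1 : ℝ)) (ω i)).symm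
  have hV' : ∀ k ω, surplus (I k) S M ω = V' k fun i => ω i := fun k ω =>
    congrArg (· - M) (Finset.sum_coe_sort S fun i => (I k).indicator (fun _ => (1 : ℝ)) (ω i)).symm
  have hmean : ∫ ω, W ω ∂P = Fintype.card κ * p * c := by
    rw [hW, integral_finsetSum _ fun k _ => hXV k]
    have h1 : ∀ k, ∫ ω, avoids (I k) B ω * surplus (I k) S M ω ∂P = p * c := by
      intro k
      have h2 := hind.integral_fun_comp_mul_comp (hrm B).aemeasurable (hrm S).aemeasurable
        (hX'm k).aestronglyMeasurable (hV'm k).aestronglyMeasurable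
      simp only [← hX', ← hV'] at h2
      rw [h2, integral_avoids ν (hI k), integral_surplus ν (hI k), hq k]
    simp only [h1, Finset.sum_const, Finset.card_univ, nsmul_eq_mul]
    ring
  have hsecond : ∫ ω, W ω ^ 2 ∂P ≤
      (Fintype.card κ * p * c) ^ 2 + Fintype.card κ * p * (c ^ 2 + S.card * q) := by
    have h1 : ∀ j k, ∫ ω, avoids (I j) B ω * surplus (I j) S M ω *
        (avoids (I k) B ω * surplus (I k) S M ω) ∂P ≤
        p ^ 2 * c ^ 2 + if j = k then p * (c ^ 2 + S.card * q) else 0 := by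
      intro j k
      have h2 := hind.integral_fun_comp_mul_comp (hrm B).aemeasurable (hrm S).aemeasurable
        ((hX'm j).mul (hX'm k)).aestronglyMeasurable ((hV'm j).mul (hV'm k)).aestronglyMeasurable
      simp only [Pi.mul_apply, ← hX', ← hV'] at h2
      have h3 : ∀ ω, avoids (I j) B ω * surplus (I j) S M ω *
          (avoids (I k) B ω * surplus (I k) S M ω) = avoids (I j) B ω * avoids (I k) B ω *
            (surplus (I j) S M ω * surplus (I k) S M ω) := fun ω => by ring
      simp only [h3]
      rw [h2]
      have hnn : 0 ≤ ∫ ω, avoids (I j) B ω * avoids (I k) B ω ∂P := integral_nonneg fun ω =>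
        mul_nonneg (avoids_mem_Icc (I j) B ω).1 (avoids_mem_Icc (I k) B ω).1
      by_cases hjk : j = k
      · subst hjk
        have h4 : ∫ ω, avoids (I j) B ω * avoids (I j) B ω ∂P ≤ p := by
          have h5 := integral_avoids ν (hI j) B
          rw [hq j] at h5
          rw [hp, ← h5]
          refine integral_mono_of_nonneg (Eventually.of_forall fun ω => ?_)
            (integrable_of_abs_le (C := 1) (hXm j) fun ω => ?_) (Eventually.of_forall fun ω => ?_)
          · exact mul_nonneg (avoids_mem_Icc (I j) B ω).1 (avoids_mem_Icc (I j) B ω).1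
          · rw [abs_of_nonneg (avoids_mem_Icc (I j) B ω).1]
            exact (avoids_mem_Icc (I j) B ω).2
          · exact mul_le_of_le_one_left (avoids_mem_Icc (I j) B ω).1 (avoids_mem_Icc (I j) B ω).2
        have h5 := integral_surplus_mul_le ν (hI j) (hI j) (δ := 1) (hq j) (hq j)
          (by rw [inter_self, hq j, one_mul]) S M
        rw [one_mul, ← hc] at h5
        have h6 : 0 ≤ c ^ 2 + S.card * q := by
          have : 0 ≤ S.card * q := hM.trans hMS.le
          positivity
        rw [if_pos rfl]
        have h7 := (mul_le_mul_of_nonneg_left h5 hnn).trans (mul_le_mul_of_nonneg_right h4 h6)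
        have h8 : 0 ≤ p ^ 2 * c ^ 2 := by positivity
        linarith
      · have h4 := integral_avoids_mul_le ν (hI j) (hI k) (hd hjk) B
        rw [hq j, hq k, ← pow_two] at h4
        have h5 := integral_surplus_mul_le ν (hI j) (hI k) (δ := 0) (hq j) (hq k)
          (by rw [(hd hjk).inter_eq, measureReal_empty, zero_mul]) S M
        rw [zero_mul, add_zero] at h5
        rw [if_neg hjk, add_zero]
        exact (mul_le_mul_of_nonneg_left h5 hnn).trans
          (mul_le_mul_of_nonneg_right h4 (sq_nonneg c))
    have h2 : ∀ ω, W ω ^ 2 = ∑ j, ∑ k, avoids (I j) B ω * surplus (I j) S M ω *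
        (avoids (I k) B ω * surplus (I k) S M ω) := fun ω => by
      rw [hW, pow_two, Finset.sum_mul_sum]
    simp only [h2]
    rw [integral_finsetSum _ fun j _ => integrable_finsetSum _ fun k _ => hXVXV j k]
    calc ∑ j, ∫ ω, ∑ k, avoids (I j) B ω * surplus (I j) S M ω *
          (avoids (I k) B ω * surplus (I k) S M ω) ∂P
        ≤ ∑ j, ∑ k, (p ^ 2 * c ^ 2 + if j = k then p * (c ^ 2 + S.card * q) else 0) := by
          refine Finset.sum_le_sum fun j _ => ?_
          rw [integral_finsetSum _ fun k _ => hXVXV j k]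
          exact Finset.sum_le_sum fun k _ => h1 j k
      _ = _ := by
          simp only [Finset.sum_add_distrib, Finset.sum_const, Finset.sum_ite_eq,
            Finset.mem_univ, if_true, nsmul_eq_mul, Finset.card_univ]
          ring
  have hWm : Measurable W := Finset.measurable_fun_sum _ fun k _ => (hXm k).mul (hVm k)
  have hWL : MemLp W 2 P := by
    refine MemLp.of_bound hWm.aestronglyMeasurable (Fintype.card κ * (S.card + M))
      (Eventually.of_forall fun ω => ?_)
    refine (Finset.abs_sum_le_sum_abs _ _).trans ?_
    have := Finset.sum_le_card_nsmul Finset.univ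
      (fun k => |avoids (I k) B ω * surplus (I k) S M ω|) _ fun k _ => hXVbound k ω
    rwa [nsmul_eq_mul, Finset.card_univ] at this
  have hpos : 0 < Fintype.card κ * p * c := by positivity
  have hcheb := ProbabilityTheory.meas_ge_le_variance_div_sq hWL hpos
  have hvar : ProbabilityTheory.variance W P ≤ Fintype.card κ * p * (c ^ 2 + S.card * q) := by
    rw [ProbabilityTheory.variance_eq_sub hWL, hmean]
    have : ∫ ω, (W ^ 2) ω ∂P = ∫ ω, W ω ^ 2 ∂P := rfl
    linarith
  refine (measure_mono fun ω hω => ?_).trans (hcheb.trans (ENNReal.ofReal_le_ofReal ?_))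
  · have h1 : W ω ≤ 0 := Finset.sum_nonpos fun k _ => hω k
    rw [mem_ofPred_eq, hmean, abs_of_nonpos (by linarith)]
    linarith
  · calc ProbabilityTheory.variance W P / (Fintype.card κ * p * c) ^ 2
        ≤ Fintype.card κ * p * (c ^ 2 + S.card * q) / (Fintype.card κ * p * c) ^ 2 := by gcongr
      _ = _ := by field_simp

end Boxes

/-! ### Isolated runs in the random order -/

theorem measurableSet_lt_totalOrder {α : Type*} (i j : α) :
    MeasurableSet {o : TotalOrder α | o.lt i j} := by
  classical
  set F : Finset α := {i, j} with hF
  have hi : i ∈ F := by simp [hF]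
  have hj : j ∈ F := by simp [hF]
  have hfin : Finite (TotalOrder F) :=
    Finite.of_injective (fun t : TotalOrder F => t.lt) fun t t' h => TotalOrder.ext h
  have h1 : {o : TotalOrder α | o.lt i j} =
      ⋃ t ∈ {t : TotalOrder F | t.lt ⟨i, hi⟩ ⟨j, hj⟩}, orderCylinder F t := by
    ext o
    simp [orderCylinder, TotalOrder.restrict]
  rw [h1]
  exact MeasurableSet.biUnion (to_countable _) fun t _ =>
    MeasurableSpace.measurableSet_generateFrom ⟨F, t, rfl⟩

/-- Isolated runs are events of the σ-algebra on the orders themselves, so their probability can be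
computed on the samples. -/
theorem measurableSet_isolatedRun (B S : Finset ℕ+) (M : ℝ) :
    MeasurableSet (isolatedRun B S M) := by
  have h1 : isolatedRun B S M = ⋃ T ∈ {T | T ∈ S.powerset ∧ M < (T.card : ℝ)},
      ⋂ i ∈ T, ⋂ j ∈ T, ⋂ b ∈ B, ({o | o.lt i b} ∩ {o | o.lt b j})ᶜ := by
    ext o
    simp only [isolatedRun, mem_ofPred_eq, mem_iUnion, mem_iInter, mem_compl_iff, mem_inter_iff,
      exists_prop, and_assoc]
  rw [h1]
  exact MeasurableSet.biUnion (to_countable _) fun T _ =>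
    Finset.measurableSet_biInter _ fun i _ => Finset.measurableSet_biInter _ fun j _ =>
      Finset.measurableSet_biInter _ fun b _ =>
        ((measurableSet_lt_totalOrder i b).inter (measurableSet_lt_totalOrder b j)).compl

/-- The `k`-th of `Q` half-open intervals that divide the unit interval. -/
def unitBox (Q : ℕ) (k : Fin Q) : Set unitInterval :=
  {u | (u : ℝ) ∈ Ico ((k : ℝ) / Q) ((k + 1 : ℝ) / Q)}

theorem measurableSet_unitBox (Q : ℕ) (k : Fin Q) : MeasurableSet (unitBox Q k) :=
  measurable_subtype_coe measurableSet_Ico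

theorem volume_unitBox (Q : ℕ) (k : Fin Q) :
    (volume : Measure unitInterval).real (unitBox Q k) = 1 / Q := by
  have hQ : (0 : ℝ) < Q := by exact_mod_cast k.pos
  have hk : (k : ℝ) + 1 ≤ Q := by exact_mod_cast k.isLt
  have himg : ((↑) : unitInterval → ℝ) '' unitBox Q k = Ico ((k : ℝ) / Q) ((k + 1 : ℝ) / Q) := by
    ext x
    constructor
    · rintro ⟨u, hu, rfl⟩
      exact hu
    · intro hx
      have h0 : 0 ≤ (k : ℝ) / Q := by positivity
      have h1 : (k + 1 : ℝ) / Q ≤ 1 := (div_le_one hQ).2 hk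
      exact ⟨⟨x, h0.trans hx.1, hx.2.le.trans h1⟩, hx, rfl⟩
  rw [Measure.real, Measure.Subtype.volume_def, comap_subtype_coe_apply measurableSet_Icc, himg,
    Real.volume_Ico, ENNReal.toReal_ofReal] <;> rw [← sub_div, add_sub_cancel_left]
  positivity

theorem pairwise_disjoint_unitBox (Q : ℕ) :
    Pairwise (Function.onFun Disjoint (unitBox Q)) := by
  have h : ∀ j k : Fin Q, j < k → Disjoint (unitBox Q j) (unitBox Q k) := by
    intro j k hjk
    refine Set.disjoint_left.2 fun u hj hk => ?_
    have h1 : (j : ℝ) + 1 ≤ k := by exact_mod_cast hjk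
    have h2 : (j + 1 : ℝ) / Q ≤ k / Q := by gcongr
    exact absurd (hj.2.trans_le (h2.trans hk.1)) (lt_irrefl _)
  intro j k hjk
  rcases lt_or_gt_of_ne hjk with h' | h'
  exacts [h j k h', (h k j h').symm]

/-- A box that contains no point of `B` and many points of `S` yields an isolated run. -/
theorem orderOfSample_mem_isolatedRun {Q : ℕ} {B S : Finset ℕ+} {M : ℝ} {ω : ℕ+ → unitInterval}
    {k : Fin Q} (h : 0 < avoids (unitBox Q k) B ω * surplus (unitBox Q k) S M ω) :
    orderOfSample ω ∈ isolatedRun B S M := by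
  classical
  have hX := (avoids_mem_Icc (unitBox Q k) B ω).1
  have hV : 0 < surplus (unitBox Q k) S M ω := pos_of_mul_pos_right h hX
  have hB : ∀ b ∈ B, ω b ∉ unitBox Q k := by
    intro b hb hmem
    have : avoids (unitBox Q k) B ω = 0 := Finset.prod_eq_zero hb (by simp [hmem])
    rw [this, zero_mul] at h
    exact lt_irrefl _ h
  refine ⟨S.filter fun i => ω i ∈ unitBox Q k, ?_, ?_, ?_⟩
  · exact Finset.mem_powerset.2 (Finset.filter_subset _ _)
  · rw [surplus, sub_pos] at hV
    convert hV using 1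
    simp [Set.indicator_apply]
  · rintro i hi j hj b hb ⟨hib, hbj⟩
    have hi' := (Finset.mem_filter.1 hi).2
    have hj' := (Finset.mem_filter.1 hj).2
    have h1 : ω i ≤ ω b := hib.elim le_of_lt fun h => h.1.le
    have h2 : ω b ≤ ω j := hbj.elim le_of_lt fun h => h.1.le
    exact hB b hb ⟨hi'.1.trans h1, (show (ω b : ℝ) ≤ ω j from h2).trans_lt hj'.2⟩

/-- Bernoulli's inequality for half of the exponent, squared. -/
theorem one_fourth_le_pow {n : ℕ} (hn : 1 ≤ n) :
    (1 / 4 : ℝ) ≤ (1 - 1 / (2 : ℝ) ^ n) ^ 2 ^ n := by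
  obtain ⟨n, rfl⟩ : ∃ k, n = k + 1 := ⟨n - 1, by omega⟩
  have h1 : (1 : ℝ) ≤ 2 ^ n := one_le_pow₀ one_le_two
  have h2 : 1 / (2 : ℝ) ^ (n + 1) ≤ 1 / 2 := by
    refine one_div_le_one_div_of_le two_pos ?_
    rw [pow_succ]
    linarith
  have h3 := one_add_mul_le_pow (a := -(1 / (2 : ℝ) ^ (n + 1))) (by linarith) (2 ^ n)
  have h4 : (1 : ℝ) + ((2 ^ n : ℕ) : ℝ) * -(1 / (2 : ℝ) ^ (n + 1)) = 1 / 2 := by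
    push_cast
    rw [pow_succ]
    field_simp
    norm_num
  rw [h4, ← sub_eq_add_neg] at h3
  calc (1 / 4 : ℝ) = (1 / 2) ^ 2 := by norm_num
    _ ≤ ((1 - 1 / (2 : ℝ) ^ (n + 1)) ^ 2 ^ n) ^ 2 := by gcongr
    _ = _ := by rw [← pow_mul, ← pow_succ]

/-- The indices below `2 ^ N`. -/
def headIndices (N : ℕ) : Finset ℕ+ := Finset.Ico 1 (2 ^ N)

/-- The dyadic block of indices that starts at `2 ^ N`. -/
def blockIndices (N : ℕ) : Finset ℕ+ := Finset.Ico (2 ^ N) (2 ^ (N + 1))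

theorem disjoint_headIndices_blockIndices (N : ℕ) :
    Disjoint (headIndices N) (blockIndices N) :=
  Finset.disjoint_left.2 fun _ h h' =>
    absurd (Finset.mem_Ico.1 h).2 (not_lt.2 (Finset.mem_Ico.1 h').1)

/-- With `2 ^ 4 ^ m` boxes and `2 ^ m` times as many points in the head and in the next block, it
is unlikely that no empty box contains half the expected number `2 ^ m` of points of the block:
a box is empty with a probability of about `exp (-2 ^ m)`, and `2 ^ 4 ^ m` is far larger than
the reciprocal. -/
theorem orderMeasure_compl_isolatedRun_le (m : ℕ) :
    orderMeasure (isolatedRun (headIndices (4 ^ m + m)) (blockIndices (4 ^ m + m)) (2 ^ m / 2))ᶜ ≤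
      ENNReal.ofReal (20 * (1 / 2) ^ m) := by
  set N := 4 ^ m + m with hN
  have hn : 1 ≤ 4 ^ m := Nat.one_le_pow _ _ (by norm_num)
  have hQ1 : (2 : ℝ) ≤ 2 ^ 4 ^ m := by
    calc (2 : ℝ) = 2 ^ 1 := (pow_one _).symm
      _ ≤ _ := pow_le_pow_right₀ one_le_two hn
  have hQ0 : (0 : ℝ) < 2 ^ 4 ^ m := by linarith
  have hcard : ((blockIndices N).card : ℝ) * (1 / ((2 ^ 4 ^ m : ℕ) : ℝ)) = 2 ^ m := by
    rw [blockIndices, card_Ico_two_pow]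
    push_cast
    rw [hN, pow_add]
    field_simp
  have hne : Nonempty (Fin (2 ^ 4 ^ m)) := ⟨⟨0, by positivity⟩⟩
  have hlt : 1 / ((2 ^ 4 ^ m : ℕ) : ℝ) < 1 := by
    push_cast
    rw [div_lt_one hQ0]
    linarith
  have hx : (1 : ℝ) ≤ 2 ^ m := one_le_pow₀ one_le_two
  have hmain := measure_forall_box_le (volume : Measure unitInterval)
    (measurableSet_unitBox (2 ^ 4 ^ m)) (pairwise_disjoint_unitBox _) (volume_unitBox _) hlt
    (disjoint_headIndices_blockIndices N) (M := 2 ^ m / 2) (by positivity)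
    (by rw [hcard]; linarith)
  rw [orderMeasure, Measure.map_apply measurable_orderOfSample
    (measurableSet_isolatedRun _ _ _).compl]
  refine (measure_mono fun ω hω k => ?_).trans (hmain.trans (ENNReal.ofReal_le_ofReal ?_))
  · by_contra! hk
    exact hω (orderOfSample_mem_isolatedRun hk)
  · rw [hcard, Fintype.card_fin]
    push_cast
    set x : ℝ := 2 ^ m with hxdef
    set p : ℝ := (1 - 1 / 2 ^ 4 ^ m) ^ (headIndices N).card with hp
    have hb0 : (0 : ℝ) ≤ 1 - 1 / 2 ^ 4 ^ m := by
      push_cast at hlt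
      linarith
    have hb1 : (1 - 1 / 2 ^ 4 ^ m : ℝ) ≤ 1 := by
      have : (0 : ℝ) < 1 / 2 ^ 4 ^ m := by positivity
      linarith
    have hpx : (1 / 4 : ℝ) ^ 2 ^ m ≤ p := by
      have h1 : (headIndices N).card ≤ 2 ^ 4 ^ m * 2 ^ m := by
        rw [headIndices, PNat.card_Ico, PNat.pow_coe, ← pow_add]
        exact Nat.sub_le _ _
      calc (1 / 4 : ℝ) ^ 2 ^ m ≤ ((1 - 1 / (2 : ℝ) ^ 4 ^ m) ^ 2 ^ 4 ^ m) ^ 2 ^ m := by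
            gcongr
            exact one_fourth_le_pow hn
        _ = (1 - 1 / (2 : ℝ) ^ 4 ^ m) ^ (2 ^ 4 ^ m * 2 ^ m) := (pow_mul _ _ _).symm
        _ ≤ p := pow_le_pow_of_le_one hb0 hb1 h1
    have hexp : 2 * 2 ^ m + m ≤ 4 ^ m + 2 := by
      have h1 : m < 2 ^ m := Nat.lt_two_pow_self
      have h2 : 4 ^ m = 2 ^ m * 2 ^ m := by rw [← mul_pow]; norm_num
      rw [h2]
      nlinarith [sq_nonneg ((2 : ℤ) ^ m - 2)]
    have hmul : x * 4 ^ 2 ^ m ≤ 4 * 2 ^ 4 ^ m := by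
      calc x * 4 ^ 2 ^ m = (2 : ℝ) ^ (2 * 2 ^ m + m) := by
            rw [pow_add, pow_mul, hxdef]
            norm_num
            ring
        _ ≤ 2 ^ (4 ^ m + 2) := pow_le_pow_right₀ one_le_two hexp
        _ = _ := by rw [pow_add]; ring
    have hp0 : (0 : ℝ) < (1 / 4 : ℝ) ^ 2 ^ m := by positivity
    have hp1 : 0 < p := hp0.trans_le hpx
    have h5 : x ≤ 4 * 2 ^ 4 ^ m * p := by
      have h6 : x = x * 4 ^ 2 ^ m * (1 / 4) ^ 2 ^ m := by
        rw [mul_assoc, ← mul_pow]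
        norm_num
      rw [h6]
      exact mul_le_mul hmul hpx hp0.le (by positivity)
    have hc : x - x / 2 = x / 2 := by ring
    have h7 : (20 : ℝ) * (1 / 2) ^ m = 20 / x := by
      rw [one_div, inv_pow, hxdef, div_eq_mul_inv]
    rw [hc, h7, div_le_div_iff₀ (by positivity) (by positivity)]
    have h8 : (x / 2) ^ 2 + x ≤ 5 * (x / 2) ^ 2 := by nlinarith
    calc ((x / 2) ^ 2 + x) * x ≤ 5 * (x / 2) ^ 2 * (4 * 2 ^ 4 ^ m * p) := by gcongr
      _ = _ := by ring

theorem ae_eventually_isolatedRun : ∀ᵐ o ∂orderMeasure, ∀ᶠ m : ℕ in atTop,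
    o ∈ isolatedRun (headIndices (4 ^ m + m)) (blockIndices (4 ^ m + m)) (2 ^ m / 2) := by
  have hsum : Summable fun m : ℕ => 20 * (1 / 2 : ℝ) ^ m :=
    (summable_geometric_of_lt_one (by norm_num) (by norm_num)).mul_left 20
  have h := ae_eventually_notMem (μ := orderMeasure) (s := fun m : ℕ =>
    (isolatedRun (headIndices (4 ^ m + m)) (blockIndices (4 ^ m + m)) (2 ^ m / 2))ᶜ)
    (ne_top_of_le_ne_top hsum.tsum_ofReal_ne_top
      (ENNReal.tsum_le_tsum orderMeasure_compl_isolatedRun_le))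
  filter_upwards [h] with o ho
  filter_upwards [ho] with m hm
  exact notMem_compl_iff.1 hm

theorem ae_one_le_upperPhiDim_orderedSet {a : ℕ+ → ℝ} (ha : IsLevelComparable a) {Φ : ℝ → ℝ}
    (hΦ : IsDimensionFunction Φ)
    (h : Φ =o[𝓝[>] 0] fun x : ℝ => Real.log |Real.log x| / |Real.log x|) :
    ∀ᵐ o ∂orderMeasure, 1 ≤ upperPhiDim Φ (orderedSet a o) := by
  obtain ⟨C, hC, hCa⟩ := ha.exists_le_mul_avgLength
  obtain ⟨c, hc, hca⟩ := ha.exists_mul_avgLength_le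
  obtain ⟨h1, h2, h3⟩ := scales_admissible ha hΦ h (half_pos hc) (N := fun m => 4 ^ m + m)
    (fun m => Nat.le_add_left _ _) (fun m => by
      have : m < 4 ^ m := Nat.lt_pow_self (by norm_num)
      omega)
  filter_upwards [ae_eventually_isolatedRun] with o ho
  refine one_le_upperPhiDim hC.le (fun m => ha.avgLength_pos _) h1 h2 h3 ?_
  filter_upwards [ho] with m hm
  have hs := ha.avgLength_pos (4 ^ m + m)
  have h4 := exists_interval_of_isolatedRun ha.nonneg ha.hasSum.summable
    (ℓ := c * avgLength a (4 ^ m + m)) (g := C * avgLength a (4 ^ m + m)) (by positivity)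
    (mul_pos hC hs).le (mul_pos hc hs).le
    (fun i hi => (hca _).trans (ha.anti (Finset.mem_Ico.1 hi).2.le))
    (fun i hi => (ha.anti (not_lt.1 fun h' => hi (Finset.mem_Ico.2 ⟨one_le, h'⟩))).trans (hCa _))
    (disjoint_headIndices_blockIndices _) hm
  rwa [show (2 : ℝ) ^ m / 2 * (c * avgLength a (4 ^ m + m)) =
    c / 2 * 2 ^ m * avgLength a (4 ^ m + m) by ring] at h4

theorem countable_decreasingSet (a : ℕ+ → ℝ) : (decreasingSet a).Countable :=
  (countable_range _).insert 0

end CompSets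

theorem theorem4p3 (a : ℕ+ → ℝ) (ha : IsLevelComparable a)
    (Φ : ℝ → ℝ) (hΦ : IsDimensionFunction Φ) :
    -- the two forms of the smallness assumption are equivalent
    ((Φ =o[𝓝[>] 0] fun x : ℝ => Real.log |Real.log x| / |Real.log x|) ↔
      ((fun n : ℕ => (depth Φ a n : ℝ)) =o[atTop] fun n : ℕ => Real.log n)) ∧
    ((Φ =o[𝓝[>] 0] fun x : ℝ => Real.log |Real.log x| / |Real.log x|) →
      -- almost every rearrangement has upper dimension one
      (∀ᵐ o ∂orderMeasure, upperPhiDim Φ (orderedSet a o) = 1) ∧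
      -- one is the largest value on the family, and the decreasing countable set attains it
      (∀ E ∈ complementarySets a, upperPhiDim Φ E ≤ 1) ∧
      decreasingSet a ∈ complementarySets a ∧ (decreasingSet a).Countable ∧
      upperPhiDim Φ (decreasingSet a) = 1) := by
  refine ⟨⟨isLittleO_depth_of_isLittleO ha hΦ, isLittleO_of_isLittleO_depth ha hΦ⟩, fun h =>
    ⟨?_, fun E _ => upperPhiDim_le_one hΦ E,
      decreasingSet_mem_complementarySets ha.nonneg ha.hasSum, countable_decreasingSet a,
      (upperPhiDim_le_one hΦ _).antisymm (one_le_upperPhiDim_decreasingSet ha hΦ h)⟩⟩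
  filter_upwards [ae_one_le_upperPhiDim_orderedSet ha hΦ h] with o ho
  exact (upperPhiDim_le_one hΦ _).antisymm ho
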